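/- Fix $m\in(0,1)$. Let $\mathcal P_m$ be the set of probability laws on $[0,1]$ with mean $\le m$ and, for $a\in\mathbb R$, let $\mathcal Q_a$ be the set of probability laws on $[0,1]$ with mean $>a$. For $Q\in\mathcal Q_m$ put $\mathrm{KL}_{\inf}(Q;m)=\inf_{P\in\mathcal P_m}\mathrm{KL}(Q\|P)$. Let $\Lambda\subset(0,1)$ be any countable set that is dense in $(0,1)$, and let $(w_\lambda)_{\lambda\in\Lambda}$ be any weights with $w_\lambda>0$ and $\sum_{\lambda\in\Lambda}w_\lambda=1$. For observations $X_1,X_2,\dots\in[0,1]$ put $L_\lambda(x)=1-\lambda+\frac{\lambda}{m}x$, $$R^{(\lambda)}_n=\sum_{k=1}^n\prod_{i=k}^nL_\lambda(X_i),\qquad M_n=\sum_{\lambda\in\Lambda}w_\lambda R^{(\lambda)}_n,\qquad T^{BM}_\gamma=\inf\{n\ge1:M_n\ge\gamma\}\quad(\inf\emptyset=\infty).$$ Let $\mathbb E_{P^\infty}$ be expectation when all $X_i$ are i.i.d. from $P$, and let $\mathbb E^{(P)}_{k,Q}$ be expectation when the $X_i$ are independent, $X_1,\dots,X_{k-1}$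 having law $P$ and $X_k,X_{k+1},\dots$ having law $Q$. For a nonempty set $\mathcal S\subseteq\mathcal P_m$ of pre-change laws put $$\mathcal C^{\mathcal S}_Q(T)=\sup_{P\in\mathcal S}\ \sup_{k\ge1}\ \mathbb E^{(P)}_{k,Q}\big[(T-k+1)^+\,\big|\,T\ge k\big],$$ where those $k$ for which $\{T\ge k\}$ has probability zero are left out; $\mathcal S=\{P\}$ is the case of a given pre-change law $P$, and $\mathcal S=\mathcal P_m$ is the worst case. Then: (i) $\inf_{P\in\mathcal P_m}\mathbb E_{P^\infty}[T^{BM}_\gamma]\ge\gamma$ for all $\gamma>0$. (ii) For every $Q\in\mathcal Q_m$ and every nonempty $\mathcal S\subseteq\mathcal P_m$, $$\lim_{\gamma\to\infty}\frac{\mathcal C^{\mathcal S}_Q(T^{BM}_\gamma)}{\log\gamma}=\frac1{\mathrm{KL}_{\inf}(Q;m)}.$$ (iii) For every $\Delta\in(0,1-m)$ and every assignment of a nonempty set $\mathcal S_Q\subseteq\mathcal P_m$ to each probability law $Q$ on $[0,1]$, $$\lim_{\gamma\to\infty}\ \sup_{Q\in\mathcal Q_{m+\Delta}}\frac{\mathrm{KL}_{\inf}(Q;m)\,\mathcal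 C^{\mathcal S_Q}_Q(T^{BM}_\gamma)}{\log\gamma}=1.$$ -/

import Mathlib

open MeasureTheory ProbabilityTheory Filter Topology
open scoped ENNReal

namespace BoundedMean

noncomputable section

/-- Laws on the observation space `[0,1]`. -/
abbrev Law : Type := ProbabilityMeasure unitInterval

/-- Observation sequences. The observation `X_i`, `i = 1, 2, …`, is the coordinate `ω (i - 1)`. -/
abbrev Path : Type := ℕ → unitInterval

/-- The mean of a law on `[0,1]`. -/
def mean (P : Law) : ℝ := ∫ x, (x : ℝ) ∂(P : Measure unitInterval)

/-- The null (pre-change) class: laws on `[0,1]` with mean at most `m`. -/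
def preClass (m : ℝ) : Set Law := {P | mean P ≤ m}

/-- The alternative (post-change) class: laws on `[0,1]` with mean larger than `m`. -/
def postClass (m : ℝ) : Set Law := {Q | m < mean Q}

/-- `KL_inf(Q; m)`, the infimum of `KL(Q ‖ P)` over the null class. -/
def klInf (Q : Law) (m : ℝ) : ℝ≥0∞ :=
  ⨅ P ∈ preClass m,
    InformationTheory.klDiv (Q : Measure unitInterval) (P : Measure unitInterval)

/-- The no-change law `P^∞`: all observations are i.i.d. from `P`. -/
def noChange (P : Law) : Measure Path :=
  Measure.infinitePi fun _ : ℕ => (P : Measure unitInterval)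

/-- The law with change time `k ≥ 1`: the observations are independent, `X_1, …, X_{k-1}` have
law `P`, and `X_k, X_{k+1}, …` have law `Q`. -/
def changeAt (P Q : Law) (k : ℕ) : Measure Path :=
  Measure.infinitePi fun i : ℕ =>
    ((if i + 1 < k then P else Q : Law) : Measure unitInterval)

/-- The average run length `E_{P^∞}[T]`. -/
def arl (P : Law) (T : Path → ℕ∞) : ℝ≥0∞ := ∫⁻ ω, (T ω : ℝ≥0∞) ∂(noChange P)

/-- The conditional expected delay `E_{k,Q}[(T - k + 1)^+ | T ≥ k]` with pre-change law `P`.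
The subtraction in `ℝ≥0∞` is truncated at `0`. If `T ≥ k` has probability zero, the conditional
measure is zero, and such a `k` does not contribute to the supremum in `cadd`. -/
def delayAt (P Q : Law) (k : ℕ) (T : Path → ℕ∞) : ℝ≥0∞ :=
  ∫⁻ ω, ((T ω : ℝ≥0∞) + 1 - (k : ℝ≥0∞)) ∂(cond (changeAt P Q k) {ω | (k : ℕ∞) ≤ T ω})

/-- The conditional average delay to detection of `T`: the supremum of the conditional expected
delay over all change times `k ≥ 1` and all pre-change laws in `S`. For `S = {P}` this is the
delay for the pre-change law `P`, for the full null class it is the worst-case delay. -/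
def cadd (S : Set Law) (Q : Law) (T : Path → ℕ∞) : ℝ≥0∞ :=
  ⨆ P ∈ S, ⨆ k : ℕ, ⨆ _ : 1 ≤ k, delayAt P Q k T

/-- The betting factor `L_l(x) = 1 - l + l x / m`. -/
def bet (m l x : ℝ) : ℝ := 1 - l + l / m * x

/-- The Shiryaev–Roberts statistic `R_n = ∑_{k=1}^n ∏_{i=k}^n L_l(X_i)`. -/
def srStat (m l : ℝ) (n : ℕ) (ω : Path) : ℝ :=
  ∑ k ∈ Finset.Icc 1 n, ∏ i ∈ Finset.Icc k n, bet m l (ω (i - 1))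

/-- The mixture statistic `M_n = ∑_{l ∈ Λ} w_l R_n^{(l)}`. -/
def mixStat (m : ℝ) (Λ : Set ℝ) (w : Λ → ℝ) (n : ℕ) (ω : Path) : ℝ :=
  ∑' l : Λ, w l * srStat m l n ω

/-- The bounded-mean detector `inf {n ≥ 1 : M_n ≥ γ}`, equal to `⊤` if there is no such `n`. -/
def detector (m : ℝ) (Λ : Set ℝ) (w : Λ → ℝ) (γ : ℝ) (ω : Path) : ℕ∞ :=
  ⨅ n : ℕ, ⨅ _ : 1 ≤ n ∧ γ ≤ mixStat m Λ w n ω, (n : ℕ∞)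

end

end BoundedMean

open BoundedMean

/-!
The statistic `M_n` satisfies `E[M_{n+1} | X_1, …, X_n] ≤ 1 + M_n` under every law of the null
class, because each factor `L_l(X)` has mean at most one. Write `survive n` for the event `{T > n}`.
Optional stopping for `M_n - n` gives `γ P(T ≤ n) ≤ ∑_{j<n} P(T > j)` (`mul_compl_survive_le`), and
`n → ∞` gives the bound on the average run length (`le_arl_detector`).

*Lower bound on the delay* (`eventually_lt_cadd_div_log`). For the change time `k = 1` the delay is
the expectation of `T` under `Q^∞`, whatever the pre-change law. Let `P` be any law of the null
class with `KL(Q ‖ P) < K`. Then `P^∞(T ≤ N) ≤ N / γ`. A change of measure on the first `N`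
observations gives `Q^∞(T ≤ N) ≤ e^{K N} N / γ + Q^∞(likelihood ratio > e^{K N})`; the last term
vanishes by the strong law of large numbers, and the first one does for `N = β log γ` with
`K β < 1`. So the delay is at least about `β log γ`, and `K` may be taken down to `KL_inf`.

*Upper bound on the delay* (`cadd_detector_le`). The event `T ≥ k` depends on `X_1, …, X_{k-1}`
only, and `M_n ≥ w_l ∏_{i=k}^n L_l(X_i)`. Hence `T - k + 1` is at most the first passage time of the
random walk with steps `log L_l(X_i)`, `i ≥ k`, over `log (γ / w_l)`. The steps have mean
`growth m Q l` and are bounded above by `log (1 / m)`, so Wald's identity bounds the delay by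
`(log γ + C_l) / growth m Q l`, uniformly in `k` and in the pre-change law.

*Matching the two bounds.* For `η > 0` some `l` has growth at least `KL_inf - η`
(`exists_klInf_le_growth`), as the reweighted measure `L_l⁻¹ Q` is, up to a small correction, a law
of the null class at divergence `growth m Q l` from `Q`. Finitely many `l ∈ Λ` suffice for all `Q`
at once (`exists_finset_growth`), by compactness of `[0, 1]`: uniformly in `Q`, the growth drops
little when `l` is decreased by a factor close to one, because `L_{c l} ≥ c L_l` for `c ≤ 1`, and
when it is increased to a value that is still small. This makes the upper bound uniform over
separated classes (`eventually_klInf_mul_cadd_le`).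
-/

namespace BoundedMean

/-! ### The past, independence and change of measure for product laws -/

/-- The information `σ(X_1, …, X_n)` of the first `n` observations, i.e. of the coordinates
`0, …, n - 1`. -/
abbrev past (n : ℕ) : MeasurableSpace Path :=
  MeasurableSpace.comap (fun (ω : Path) (i : Finset.range n) => ω i) inferInstance

lemma past_le (n : ℕ) : past n ≤ (inferInstance : MeasurableSpace Path) := by
  refine Measurable.comap_le ?_
  fun_prop

lemma measurable_past_eval {i n : ℕ} (h : i < n) : Measurable[past n] (fun ω : Path => ω i) := by
  have h1 : Measurable[past n] (fun (ω : Path) (i : Finset.range n) => ω i) :=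
    comap_measurable _
  exact (measurable_pi_apply (⟨i, Finset.mem_range.2 h⟩ : Finset.range n)).comp h1

lemma past_mono {n k : ℕ} (h : n ≤ k) : past n ≤ past k := by
  refine Measurable.comap_le ?_
  refine @measurable_pi_lambda _ _ _ (past k) _ _ fun i => ?_
  exact measurable_past_eval (lt_of_lt_of_le (Finset.mem_range.1 i.2) h)

section Product

variable (ν : ℕ → Measure unitInterval) [∀ i, IsProbabilityMeasure (ν i)]

/-- Under a product law the next observation is independent of the past. -/
lemma indep_past_eval (n : ℕ) :
    Indep (past n) (MeasurableSpace.comap (fun ω : Path => ω n) inferInstance)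
      (Measure.infinitePi ν) := by
  have h := (iIndepFun_infinitePi (P := ν) (X := fun _ x => x) fun _ => measurable_id)
  have h2 := h.indepFun_finset (Finset.range n) {n} (by simp) (fun i => by fun_prop)
  have hψ : Measurable (fun f : ({n} : Finset ℕ) → unitInterval => f ⟨n, by simp⟩) :=
    measurable_pi_apply _
  have h3 := h2.comp measurable_id hψ
  exact h3

lemma lintegral_past_mul_eval {n : ℕ} {Φ : Path → ℝ≥0∞} (hΦ : Measurable[past n] Φ)
    {g : unitInterval → ℝ≥0∞} (hg : Measurable g) :
    ∫⁻ ω, Φ ω * g (ω n) ∂(Measure.infinitePi ν)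
      = (∫⁻ ω, Φ ω ∂(Measure.infinitePi ν)) * ∫⁻ x, g x ∂(ν n) := by
  have hc : Measurable (fun ω : Path => ω n) := measurable_pi_apply n
  have h := lintegral_mul_eq_lintegral_mul_lintegral_of_independent_measurableSpace (past_le n)
    hc.comap_le (indep_past_eval ν n) hΦ (hg.comp (comap_measurable _))
  rw [Function.comp_def] at h
  rw [h, ← Measure.infinitePi_map_eval ν n, lintegral_map hg hc]

lemma setIntegral_past_eval {n : ℕ} {s : Set Path} (hs : MeasurableSet[past n] s)
    {g : unitInterval → ℝ} (hg : Measurable g) :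
    ∫ ω in s, g (ω n) ∂(Measure.infinitePi ν)
      = (Measure.infinitePi ν).real s * ∫ x, g x ∂(ν n) := by
  have hc : Measurable (fun ω : Path => ω n) := measurable_pi_apply n
  have hs' : MeasurableSet s := past_le n s hs
  have h1 : IndepFun (s.indicator (fun _ => (1 : ℝ))) (fun ω : Path => g (ω n))
      (Measure.infinitePi ν) := by
    refine indep_of_indep_of_le_left (indep_of_indep_of_le_right (indep_past_eval ν n) ?_) ?_
    · exact (hg.comp (comap_measurable _)).comap_le
    · have hI : Measurable[past n] (s.indicator fun _ => (1 : ℝ)) :=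
        Measurable.indicator measurable_const hs
      exact hI.comap_le
  have h2 := h1.integral_fun_mul_eq_mul_integral
    (measurable_const.indicator hs').aestronglyMeasurable (hg.comp hc).aestronglyMeasurable
  rw [integral_indicator hs', setIntegral_const, smul_eq_mul, mul_one] at h2
  rw [← Measure.infinitePi_map_eval ν n, integral_map hc.aemeasurable hg.aestronglyMeasurable,
    ← h2, ← integral_indicator hs']
  refine integral_congr_ae (Eventually.of_forall fun ω => ?_)
  by_cases h : ω ∈ s <;> simp [h]

end Product

/-- On finite products, densities multiply. -/
lemma pi_withDensity_prod {ι : Type*} [Fintype ι] {P : Measure unitInterval}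
    [IsProbabilityMeasure P] {h : unitInterval → ℝ≥0∞} (hh : Measurable h)
    [IsProbabilityMeasure (P.withDensity h)] :
    Measure.pi (fun _ : ι => P.withDensity h)
      = (Measure.pi fun _ : ι => P).withDensity fun x => ∏ i, h (x i) := by
  refine Measure.pi_eq fun s hs => ?_
  have hi : iIndepFun (fun (i : ι) (x : ι → unitInterval) => (s i).indicator h (x i))
      (Measure.pi fun _ : ι => P) :=
    iIndepFun_pi (μ := fun _ : ι => P) (X := fun i => (s i).indicator h)
      fun i => (hh.indicator (hs i)).aemeasurable
  rw [withDensity_apply _ (MeasurableSet.univ_pi hs),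
    ← lintegral_indicator (MeasurableSet.univ_pi hs)]
  have h1 : ∀ x : ι → unitInterval, (Set.univ.pi s).indicator (fun x => ∏ i, h (x i)) x
      = ∏ i, (s i).indicator h (x i) := by
    intro x
    by_cases hx : x ∈ Set.univ.pi s
    · rw [Set.indicator_of_mem hx]
      exact Finset.prod_congr rfl fun i _ => (Set.indicator_of_mem (hx i trivial) h).symm
    · rw [Set.indicator_of_notMem hx]
      simp only [Set.mem_pi, Set.mem_univ, true_imp_iff, not_forall] at hx
      obtain ⟨i, hi⟩ := hx
      exact (Finset.prod_eq_zero (Finset.mem_univ i) (Set.indicator_of_notMem hi h)).symm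
  simp_rw [h1]
  rw [lintegral_prod_eq_prod_lintegral_of_indepFun _ _ hi
    fun i => (hh.indicator (hs i)).comp (measurable_pi_apply i)]
  refine Finset.prod_congr rfl fun i _ => ?_
  rw [(measurePreserving_eval (fun _ : ι => P) i).lintegral_comp (hh.indicator (hs i)),
    lintegral_indicator (hs i), withDensity_apply _ (hs i)]

/-- Change of measure on the first `n` observations: an event on which the likelihood ratio is at
most `c` is at most `c` times as probable after the change. -/
lemma infinitePi_le_mul_of_density {P Q : Measure unitInterval}
    [IsProbabilityMeasure P] [IsProbabilityMeasure Q] {h : unitInterval → ℝ≥0∞}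
    (hh : Measurable h) (hQ : P.withDensity h = Q) {n : ℕ} {s : Set Path}
    (hs : MeasurableSet[past n] s) (c : ℝ≥0∞) (hc : ∀ ω ∈ s, ∏ i ∈ Finset.range n, h (ω i) ≤ c) :
    Measure.infinitePi (fun _ : ℕ => Q) s ≤ c * Measure.infinitePi (fun _ : ℕ => P) s := by
  subst hQ
  obtain ⟨t, ht, rfl⟩ := hs
  have hr : Measurable (fun (ω : Path) (i : Finset.range n) => ω i) := by fun_prop
  have hmap : ∀ (R : Measure unitInterval) [IsProbabilityMeasure R],
      Measure.infinitePi (fun _ : ℕ => R) ((fun (ω : Path) (i : Finset.range n) => ω i) ⁻¹' t)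
        = Measure.pi (fun _ : Finset.range n => R) t := by
    intro R _
    rw [← Measure.infinitePi_map_restrict (fun _ : ℕ => R) (I := Finset.range n),
      Measure.map_apply (Finset.measurable_restrict _) ht]
    rfl
  rw [hmap, hmap, pi_withDensity_prod hh, withDensity_apply _ ht, ← setLIntegral_const]
  refine setLIntegral_mono measurable_const fun x hx => ?_
  have := hc (fun i => if hi : i ∈ Finset.range n then x ⟨i, hi⟩ else 0) (by
    have : (fun i : Finset.range n => if hi : (i : ℕ) ∈ Finset.range n then x ⟨i, hi⟩ else 0) = x :=
      funext fun i => dif_pos i.2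
    rw [Set.mem_preimage, this]
    exact hx)
  rw [← Finset.prod_coe_sort] at this
  simpa using this

/-! ### The statistic, the detector and its average run length -/

section Bet

variable {m l : ℝ}

lemma bet_ge (hm0 : 0 < m) (hl0 : 0 ≤ l) (x : unitInterval) : 1 - l ≤ bet m l x := by
  have : 0 ≤ l / m * (x : ℝ) := mul_nonneg (div_nonneg hl0 hm0.le) x.2.1
  unfold bet; linarith

lemma bet_nonneg (hm0 : 0 < m) (hl0 : 0 ≤ l) (hl1 : l ≤ 1) (x : unitInterval) :
    0 ≤ bet m l x := (sub_nonneg.2 hl1).trans (bet_ge hm0 hl0 x)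

lemma bet_pos (hm0 : 0 < m) (hl0 : 0 ≤ l) (hl1 : l < 1) (x : unitInterval) :
    0 < bet m l x := (sub_pos.2 hl1).trans_le (bet_ge hm0 hl0 x)

lemma bet_le (hm0 : 0 < m) (hm1 : m ≤ 1) (hl0 : 0 ≤ l) (hl1 : l ≤ 1) (x : unitInterval) :
    bet m l x ≤ 1 / m := by
  have h1 : l / m * (x : ℝ) ≤ l / m := mul_le_of_le_one_right (div_nonneg hl0 hm0.le) x.2.2
  have h2 : (1 - l) * 1 ≤ (1 - l) * (1 / m) :=
    mul_le_mul_of_nonneg_left ((one_le_div hm0).2 hm1) (by linarith)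
  have h3 : (1 - l) * (1 / m) + l / m = 1 / m := by ring
  unfold bet; linarith

@[fun_prop]
lemma continuous_bet (m l : ℝ) : Continuous fun x : unitInterval => bet m l x := by
  unfold bet; fun_prop

lemma integrable_of_continuous {g : unitInterval → ℝ} (hg : Continuous g) (Q : Law) :
    Integrable g (Q : Measure unitInterval) :=
  (BoundedContinuousFunction.mkOfCompact ⟨g, hg⟩).integrable _

lemma integral_bet (P : Law) :
    ∫ x, bet m l x ∂(P : Measure unitInterval) = 1 - l + l / m * mean P := by
  have h : Integrable (fun x : unitInterval => l / m * (x : ℝ)) (P : Measure unitInterval) :=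
    integrable_of_continuous (by fun_prop) P
  simp only [bet]
  rw [integral_add (integrable_const _) h, integral_const_mul, mean]
  simp

/-- Under a law of the null class a betting factor is an e-value. -/
lemma lintegral_bet_le_one (hm0 : 0 < m) (hl0 : 0 ≤ l) (hl1 : l ≤ 1) {P : Law}
    (hP : P ∈ preClass m) :
    ∫⁻ x, ENNReal.ofReal (bet m l x) ∂(P : Measure unitInterval) ≤ 1 := by
  rw [← ofReal_integral_eq_lintegral_ofReal (integrable_of_continuous (continuous_bet m l) P)
    (Eventually.of_forall fun x => bet_nonneg hm0 hl0 hl1 x), integral_bet,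
    ENNReal.ofReal_le_one]
  have h : l / m * mean P ≤ l / m * m := mul_le_mul_of_nonneg_left hP (div_nonneg hl0 hm0.le)
  rw [div_mul_cancel₀ _ hm0.ne'] at h
  linarith

end Bet

section Statistic

variable {m l : ℝ}

lemma srStat_zero (ω : Path) : srStat m l 0 ω = 0 := by simp [srStat]

lemma srStat_succ (n : ℕ) (ω : Path) :
    srStat m l (n + 1) ω = bet m l (ω n) * (1 + srStat m l n ω) := by
  unfold srStat
  rw [Finset.sum_Icc_succ_top (by omega), mul_add, mul_one, Finset.mul_sum, add_comm]
  congr 1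
  · simp
  · refine Finset.sum_congr rfl fun k hk => ?_
    rw [Finset.prod_Icc_succ_top (by have := (Finset.mem_Icc.1 hk).2; omega), mul_comm]
    simp

lemma srStat_nonneg (hm0 : 0 < m) (hl0 : 0 ≤ l) (hl1 : l ≤ 1) (n : ℕ) (ω : Path) :
    0 ≤ srStat m l n ω :=
  Finset.sum_nonneg fun _ _ => Finset.prod_nonneg fun _ _ => bet_nonneg hm0 hl0 hl1 _

lemma exists_srStat_le (hm0 : 0 < m) (hm1 : m ≤ 1) (n : ℕ) :
    ∃ B : ℝ, ∀ l : ℝ, 0 ≤ l → l ≤ 1 → ∀ ω, srStat m l n ω ≤ B := by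
  induction n with
  | zero => exact ⟨0, fun l _ _ ω => (srStat_zero ω).le⟩
  | succ n ih =>
    obtain ⟨B, hB⟩ := ih
    refine ⟨1 / m * (1 + B), fun l h0 h1 ω => ?_⟩
    rw [srStat_succ]
    have := srStat_nonneg hm0 h0 h1 n ω
    have := hB l h0 h1 ω
    exact mul_le_mul (bet_le hm0 hm1 h0 h1 _) (by linarith) (by linarith) (by positivity)

lemma measurable_srStat (m l : ℝ) (n : ℕ) : Measurable[past n] (srStat m l n) := by
  induction n with
  | zero =>
    have : srStat m l 0 = fun _ => 0 := funext srStat_zero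
    rw [this]
    exact measurable_const
  | succ n ih =>
    have : srStat m l (n + 1) = fun ω => bet m l (ω n) * (1 + srStat m l n ω) :=
      funext (srStat_succ n)
    rw [this]
    refine Measurable.mul ?_ ((ih.mono (past_mono n.le_succ) le_rfl).const_add 1)
    exact (continuous_bet m l).measurable.comp (measurable_past_eval n.lt_succ_self)

end Statistic

section Detector

variable {m : ℝ} {Λ : Set ℝ} {w : Λ → ℝ}

lemma summable_mixStat (hm0 : 0 < m) (hm1 : m < 1) (hΛs : Λ ⊆ Set.Ioo 0 1)
    (hw0 : ∀ l, 0 < w l) (hw1 : HasSum w 1) (n : ℕ) (ω : Path) :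
    Summable fun l : Λ => w l * srStat m l n ω := by
  obtain ⟨B, hB⟩ := exists_srStat_le hm0 hm1.le n
  refine Summable.of_nonneg_of_le (fun l => ?_) (fun l => ?_) (hw1.summable.mul_right B)
  · exact mul_nonneg (hw0 l).le (srStat_nonneg hm0 (hΛs l.2).1.le (hΛs l.2).2.le n ω)
  · exact mul_le_mul_of_nonneg_left (hB l (hΛs l.2).1.le (hΛs l.2).2.le ω) (hw0 l).le

lemma ofReal_mixStat (hm0 : 0 < m) (hm1 : m < 1) (hΛs : Λ ⊆ Set.Ioo 0 1)
    (hw0 : ∀ l, 0 < w l) (hw1 : HasSum w 1) (n : ℕ) (ω : Path) :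
    ENNReal.ofReal (mixStat m Λ w n ω)
      = ∑' l : Λ, ENNReal.ofReal (w l) * ENNReal.ofReal (srStat m l n ω) := by
  unfold mixStat
  rw [ENNReal.ofReal_tsum_of_nonneg (fun l => mul_nonneg (hw0 l).le
    (srStat_nonneg hm0 (hΛs l.2).1.le (hΛs l.2).2.le n ω))
    (summable_mixStat hm0 hm1 hΛs hw0 hw1 n ω)]
  exact tsum_congr fun l => ENNReal.ofReal_mul (hw0 l).le

lemma measurable_mixStat (hΛc : Λ.Countable) (n : ℕ) :
    Measurable[past n] (mixStat m Λ w n) := by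
  have : Countable Λ := hΛc.to_subtype
  let _ : MeasurableSpace Path := past n
  exact Measurable.tsum fun l : Λ => (measurable_srStat m l n).const_mul (w l)

/-- The event that the detector has not stopped by time `n`. -/
def survive (m : ℝ) (Λ : Set ℝ) (w : Λ → ℝ) (γ : ℝ) (n : ℕ) : Set Path :=
  {ω | (n : ℕ∞) < detector m Λ w γ ω}

variable {γ : ℝ}

lemma mem_survive {n : ℕ} {ω : Path} :
    ω ∈ survive m Λ w γ n ↔ ∀ j, 1 ≤ j → j ≤ n → mixStat m Λ w j ω < γ := by
  unfold survive detector
  rw [Set.mem_ofPred_eq, ← ENat.add_one_le_iff (ENat.natCast_ne_top n)]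
  simp only [le_iInf_iff]
  constructor
  · intro h j h1 h2
    by_contra! h3
    have := h j ⟨h1, h3⟩
    norm_cast at this
    omega
  · rintro h j ⟨h1, h3⟩
    by_contra! h4
    norm_cast at h4
    exact absurd (h j h1 (by omega)) (not_lt.2 h3)

lemma survive_zero : survive m Λ w γ 0 = Set.univ :=
  Set.eq_univ_of_forall fun _ => mem_survive.2 fun _ h1 h2 => by omega

lemma survive_antitone : Antitone (survive m Λ w γ) := fun _ _ h _ hω =>
  mem_survive.2 fun j h1 h2 => mem_survive.1 hω j h1 (h2.trans h)

lemma mixStat_lt_of_mem_survive {n : ℕ} (hn : 1 ≤ n) {ω : Path}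
    (hω : ω ∈ survive m Λ w γ n) : mixStat m Λ w n ω < γ := mem_survive.1 hω n hn le_rfl

lemma le_mixStat_of_mem_diff {n : ℕ} {ω : Path}
    (hω : ω ∈ survive m Λ w γ n \ survive m Λ w γ (n + 1)) : γ ≤ mixStat m Λ w (n + 1) ω := by
  by_contra! h
  refine hω.2 (mem_survive.2 fun j h1 h2 => ?_)
  rcases Nat.lt_or_eq_of_le h2 with h3 | rfl
  · exact mem_survive.1 hω.1 j h1 (by omega)
  · exact h

lemma measurableSet_survive (hΛc : Λ.Countable) (n : ℕ) :
    MeasurableSet[past n] (survive m Λ w γ n) := by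
  have h : survive m Λ w γ n
      = ⋂ j : ℕ, ⋂ _ : 1 ≤ j, ⋂ _ : j ≤ n, {ω | mixStat m Λ w j ω < γ} := by
    ext ω
    simp [mem_survive]
  rw [h]
  refine MeasurableSet.iInter fun j => MeasurableSet.iInter fun _ => MeasurableSet.iInter
    fun hj => ?_
  have hM := (measurable_mixStat (m := m) (w := w) hΛc j).mono (past_mono hj) le_rfl
  exact hM measurableSet_Iio

/-- A truncated difference of an extended natural number is a sum of tail indicators. -/
lemma toENNReal_sub_eq_tsum (t : ℕ∞) (k : ℕ) :
    (t : ℝ≥0∞) - k = ∑' j : ℕ, if ((k + j : ℕ) : ℕ∞) < t then (1 : ℝ≥0∞) else 0 := by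
  induction t using ENat.recTopCoe with
  | top =>
    have h : ∀ j : ℕ, (if ((k + j : ℕ) : ℕ∞) < ⊤ then (1 : ℝ≥0∞) else 0) = 1 := fun j =>
      if_pos (ENat.natCast_lt_top _)
    simp_rw [h, ENNReal.tsum_const_eq_top_of_ne_zero one_ne_zero]
    simp
  | coe t =>
    rw [tsum_eq_sum (s := Finset.range (t - k)) fun j hj => if_neg (by
      simp only [Finset.mem_range, not_lt] at hj
      norm_cast
      omega)]
    rw [Finset.sum_congr rfl fun j hj => if_pos (by
      simp only [Finset.mem_range] at hj
      norm_cast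
      omega)]
    simp

/-- Tail-sum formula for the expected (truncated, shifted) stopping time. -/
lemma lintegral_detector_sub (hΛc : Λ.Countable) (μ : Measure Path) (k : ℕ) :
    ∫⁻ ω, ((detector m Λ w γ ω : ℝ≥0∞) - k) ∂μ = ∑' j : ℕ, μ (survive m Λ w γ (k + j)) := by
  have hs : ∀ n, MeasurableSet (survive m Λ w γ n) := fun n =>
    past_le n _ (measurableSet_survive hΛc n)
  have h : ∀ ω, ((detector m Λ w γ ω : ℝ≥0∞) - k)
      = ∑' j : ℕ, (survive m Λ w γ (k + j)).indicator 1 ω := fun ω => by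
    rw [toENNReal_sub_eq_tsum]
    exact tsum_congr fun j => by simp [survive, Set.indicator_apply]
  simp_rw [h]
  rw [lintegral_tsum fun j => (measurable_one.indicator (hs _)).aemeasurable]
  exact tsum_congr fun j => lintegral_indicator_one (hs _)

lemma arl_eq_tsum (hΛc : Λ.Countable) (P : Law) :
    arl P (detector m Λ w γ) = ∑' j : ℕ, noChange P (survive m Λ w γ j) := by
  have h := lintegral_detector_sub (m := m) (w := w) (γ := γ) hΛc (noChange P) 0
  simpa [arl] using h

instance (P : Law) : IsProbabilityMeasure (noChange P) := by
  unfold noChange; infer_instance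

instance (P Q : Law) (k : ℕ) : IsProbabilityMeasure (changeAt P Q k) := by
  unfold changeAt; infer_instance

/-- `M_n - n` is a supermartingale under the null class, in set-integral form. -/
lemma setLIntegral_mixStat_succ_le (hm0 : 0 < m) (hm1 : m < 1) (hΛc : Λ.Countable)
    (hΛs : Λ ⊆ Set.Ioo 0 1) (hw0 : ∀ l, 0 < w l) (hw1 : HasSum w 1) {P : Law}
    (hP : P ∈ preClass m) {n : ℕ} {s : Set Path} (hs : MeasurableSet[past n] s) :
    ∫⁻ ω in s, ENNReal.ofReal (mixStat m Λ w (n + 1) ω) ∂(noChange P)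
      ≤ noChange P s + ∫⁻ ω in s, ENNReal.ofReal (mixStat m Λ w n ω) ∂(noChange P) := by
  have : Countable Λ := hΛc.to_subtype
  have hs' : MeasurableSet s := past_le n s hs
  have hR : ∀ (l : ℝ) (j : ℕ), Measurable fun ω => ENNReal.ofReal (srStat m l j ω) := fun l j =>
    ((measurable_srStat m l j).mono (past_le j) le_rfl).ennreal_ofReal
  simp_rw [ofReal_mixStat hm0 hm1 hΛs hw0 hw1]
  have hstep : ∀ l : Λ, ∫⁻ ω in s, ENNReal.ofReal (srStat m l (n + 1) ω) ∂(noChange P)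
      ≤ noChange P s + ∫⁻ ω in s, ENNReal.ofReal (srStat m l n ω) ∂(noChange P) := by
    intro l
    have h0 := (hΛs l.2).1.le
    have h1 := (hΛs l.2).2.le
    have e1 : ∀ ω, s.indicator (fun ω => ENNReal.ofReal (srStat m l (n + 1) ω)) ω
        = s.indicator (fun ω => 1 + ENNReal.ofReal (srStat m l n ω)) ω
          * ENNReal.ofReal (bet m l (ω n)) := by
      intro ω
      by_cases hω : ω ∈ s
      · have h2 := srStat_nonneg (n := n) hm0 h0 h1 ω
        simp only [Set.indicator_of_mem hω, srStat_succ]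
        rw [ENNReal.ofReal_mul (bet_nonneg hm0 h0 h1 _), ENNReal.ofReal_add zero_le_one h2,
          ENNReal.ofReal_one, mul_comm]
      · simp [hω]
    have hmeas : Measurable[past n]
        (s.indicator fun ω => 1 + ENNReal.ofReal (srStat m l n ω)) :=
      Measurable.indicator (((measurable_srStat m l n).ennreal_ofReal).const_add 1) hs
    rw [← lintegral_indicator hs', lintegral_congr e1, noChange,
      lintegral_past_mul_eval _ hmeas
        (continuous_bet m l).measurable.ennreal_ofReal, lintegral_indicator hs',
      lintegral_add_left measurable_const, setLIntegral_const, one_mul]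
    exact mul_le_of_le_one_right zero_le (lintegral_bet_le_one hm0 h0 h1 hP)
  have hT : ∀ j : ℕ, ∫⁻ ω in s, ∑' l : Λ, ENNReal.ofReal (w l) * ENNReal.ofReal (srStat m l j ω)
        ∂(noChange P)
      = ∑' l : Λ, ∫⁻ ω in s, ENNReal.ofReal (w l) * ENNReal.ofReal (srStat m l j ω)
        ∂(noChange P) :=
    fun j => lintegral_tsum fun l => ((hR l j).const_mul _).aemeasurable
  rw [hT, hT]
  have hsum : ∑' l : Λ, ENNReal.ofReal (w l) = 1 := by
    rw [← ENNReal.ofReal_tsum_of_nonneg (fun l => (hw0 l).le) hw1.summable, hw1.tsum_eq,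
      ENNReal.ofReal_one]
  calc _ ≤ ∑' l : Λ, (ENNReal.ofReal (w l) * noChange P s
        + ∫⁻ ω in s, ENNReal.ofReal (w l) * ENNReal.ofReal (srStat m l n ω) ∂(noChange P)) := by
        refine ENNReal.tsum_le_tsum fun l => ?_
        rw [lintegral_const_mul _ (hR l _), lintegral_const_mul _ (hR l _), ← mul_add]
        exact mul_le_mul_right (hstep l) _
    _ = _ := by rw [ENNReal.tsum_add, ENNReal.tsum_mul_right, hsum, one_mul]

/-- Optional stopping for `M_n - n`: a false alarm before time `n` costs `γ` per unit of
probability, and only one unit is earned per observation. -/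
lemma mul_compl_survive_le (hm0 : 0 < m) (hm1 : m < 1) (hΛc : Λ.Countable)
    (hΛs : Λ ⊆ Set.Ioo 0 1) (hw0 : ∀ l, 0 < w l) (hw1 : HasSum w 1) {P : Law}
    (hP : P ∈ preClass m) (n : ℕ) :
    ENNReal.ofReal γ * noChange P (survive m Λ w γ n)ᶜ
      ≤ ∑ j ∈ Finset.range n, noChange P (survive m Λ w γ j) := by
  have hs : ∀ n, MeasurableSet (survive m Λ w γ n) := fun n =>
    past_le n _ (measurableSet_survive hΛc n)
  suffices h : ENNReal.ofReal γ * noChange P (survive m Λ w γ n)ᶜ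
      + ∫⁻ ω in survive m Λ w γ n, ENNReal.ofReal (mixStat m Λ w n ω) ∂(noChange P)
      ≤ ∑ j ∈ Finset.range n, noChange P (survive m Λ w γ j) from le_self_add.trans h
  induction n with
  | zero => simp [survive_zero, mixStat, srStat_zero]
  | succ n ih =>
    set A := survive m Λ w γ n
    set B := survive m Λ w γ (n + 1)
    have hBA : B ⊆ A := survive_antitone n.le_succ
    have hd : Bᶜ = Aᶜ ∪ (A \ B) := by
      ext ω
      have := @hBA ω
      simp only [Set.mem_compl_iff, Set.mem_union, Set.mem_sdiff]
      tauto
    have hdisj : Disjoint Aᶜ (A \ B) := disjoint_compl_left.mono_right Set.sdiff_subset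
    have hcross : ENNReal.ofReal γ * noChange P (A \ B)
        ≤ ∫⁻ ω in A \ B, ENNReal.ofReal (mixStat m Λ w (n + 1) ω) ∂(noChange P) := by
      rw [← setLIntegral_const]
      exact setLIntegral_mono' ((hs n).diff (hs (n + 1))) fun ω hω =>
        ENNReal.ofReal_le_ofReal (le_mixStat_of_mem_diff hω)
    have hsplit := lintegral_inter_add_sdiff (μ := noChange P)
      (fun ω => ENNReal.ofReal (mixStat m Λ w (n + 1) ω)) A (hs (n + 1))
    rw [Set.inter_eq_self_of_subset_right hBA] at hsplit
    rw [hd, measure_union hdisj ((hs n).diff (hs (n + 1))), mul_add, Finset.sum_range_succ]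
    calc _ ≤ ENNReal.ofReal γ * noChange P Aᶜ
          + (∫⁻ ω in B, ENNReal.ofReal (mixStat m Λ w (n + 1) ω) ∂(noChange P)
            + ∫⁻ ω in A \ B, ENNReal.ofReal (mixStat m Λ w (n + 1) ω) ∂(noChange P)) := by
          rw [add_assoc, add_comm (∫⁻ ω in B, _ ∂_)]
          gcongr
      _ ≤ ENNReal.ofReal γ * noChange P Aᶜ + (noChange P A
            + ∫⁻ ω in A, ENNReal.ofReal (mixStat m Λ w n ω) ∂(noChange P)) := by
          rw [hsplit]
          gcongr
          exact setLIntegral_mixStat_succ_le hm0 hm1 hΛc hΛs hw0 hw1 hP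
            (measurableSet_survive hΛc n)
      _ ≤ _ := by
          rw [add_comm (noChange P A), ← add_assoc]
          gcongr

/-- The average run length bound: unless the expected run length is infinite, the detector stops
almost surely, and then the optional stopping bound passes to the limit. -/
theorem le_arl_detector (hm0 : 0 < m) (hm1 : m < 1) (hΛc : Λ.Countable)
    (hΛs : Λ ⊆ Set.Ioo 0 1) (hw0 : ∀ l, 0 < w l) (hw1 : HasSum w 1) {P : Law}
    (hP : P ∈ preClass m) : ENNReal.ofReal γ ≤ arl P (detector m Λ w γ) := by
  have hs : ∀ n, MeasurableSet (survive m Λ w γ n) := fun n =>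
    past_le n _ (measurableSet_survive hΛc n)
  rw [arl_eq_tsum hΛc]
  by_cases htop : ∑' j : ℕ, noChange P (survive m Λ w γ j) = ⊤
  · rw [htop]; exact le_top
  have h0 := ENNReal.tendsto_atTop_zero_of_tsum_ne_top htop
  have h1 : Tendsto (fun n => noChange P (survive m Λ w γ n)ᶜ) atTop (𝓝 1) := by
    simp_rw [prob_compl_eq_one_sub (hs _)]
    simpa using ENNReal.Tendsto.sub (tendsto_const_nhds (x := (1 : ℝ≥0∞))) h0
      (Or.inl ENNReal.one_ne_top)
  have h2 := ENNReal.Tendsto.const_mul (a := ENNReal.ofReal γ) h1 (Or.inl one_ne_zero)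
  rw [mul_one] at h2
  exact le_of_tendsto' h2 fun n =>
    (mul_compl_survive_le hm0 hm1 hΛc hΛs hw0 hw1 hP n).trans (ENNReal.sum_le_tsum _)

end Detector

/-! ### `KL_inf` and the growth rates of betting fractions -/

section Divergence

/-- If `P ≥ g Q`, then the density of `Q` with respect to `P` is at most `1 / g`; hence the
divergence is at most `E_Q[log (1 / g)]`. -/
lemma klDiv_le_of_withDensity_le {P Q : Law} {g : unitInterval → ℝ} (hg : Continuous g)
    (hg0 : ∀ x, 0 < g x)
    (hle : (Q : Measure unitInterval).withDensity (fun x => ENNReal.ofReal (g x))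
      ≤ (P : Measure unitInterval)) :
    InformationTheory.klDiv (Q : Measure unitInterval) (P : Measure unitInterval)
      ≤ ENNReal.ofReal (∫ x, -Real.log (g x) ∂(Q : Measure unitInterval)) := by
  have hgm : Measurable fun x => ENNReal.ofReal (g x) := hg.measurable.ennreal_ofReal
  have hac : (Q : Measure unitInterval) ≪ (P : Measure unitInterval) :=
    (withDensity_absolutelyContinuous' hgm.aemeasurable (Eventually.of_forall fun x =>
      (ENNReal.ofReal_pos.2 (hg0 x)).ne')).trans (Measure.absolutelyContinuous_of_le hle)
  have hQ := Measure.withDensity_rnDeriv_eq _ _ hac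
  have hh := Measure.measurable_rnDeriv (Q : Measure unitInterval) (P : Measure unitInterval)
  set h := (Q : Measure unitInterval).rnDeriv (P : Measure unitInterval)
  have hP : ∀ᵐ x ∂(P : Measure unitInterval), h x * ENNReal.ofReal (g x) ≤ 1 := by
    refine ae_le_of_forall_setLIntegral_le_of_sigmaFinite (hh.mul hgm) fun s hs _ => ?_
    have h1 := hle s
    rw [withDensity_apply _ hs, ← hQ, setLIntegral_withDensity_eq_setLIntegral_mul _ hh hgm hs]
      at h1
    simpa using h1
  have hP' : ∀ᵐ x ∂(P : Measure unitInterval), (h x).toReal ≤ (g x)⁻¹ := by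
    filter_upwards [hP] with x hx
    have h2 := ENNReal.toReal_mono ENNReal.one_ne_top hx
    rw [ENNReal.toReal_mul, ENNReal.toReal_ofReal (hg0 x).le, ENNReal.toReal_one] at h2
    rw [← one_div]
    exact (le_div_iff₀ (hg0 x)).2 h2
  have hgi : Continuous fun x => (g x)⁻¹ := hg.inv₀ fun x => (hg0 x).ne'
  obtain ⟨C, hC⟩ := isCompact_univ.exists_bound_of_continuousOn hgi.continuousOn
  obtain ⟨D, hD⟩ := (isCompact_Icc (a := (0 : ℝ)) (b := C)).exists_bound_of_continuousOn
    InformationTheory.continuous_klFun.continuousOn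
  have hint : Integrable (llr (Q : Measure unitInterval) (P : Measure unitInterval))
      (Q : Measure unitInterval) := by
    rw [← InformationTheory.integrable_klFun_rnDeriv_iff hac]
    refine Integrable.of_bound (C := D)
      (InformationTheory.measurable_klFun.comp hh.ennreal_toReal).aestronglyMeasurable ?_
    filter_upwards [hP'] with x hx
    refine hD _ ⟨ENNReal.toReal_nonneg, hx.trans ?_⟩
    exact (le_abs_self _).trans (hC x trivial)
  rw [InformationTheory.klDiv_of_ac_of_integrable hac hint]
  refine ENNReal.ofReal_le_ofReal ?_
  simp only [probReal_univ, add_sub_cancel_right]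
  refine integral_mono_ae hint
    (integrable_of_continuous ((hg.log fun x => (hg0 x).ne').neg) Q) ?_
  filter_upwards [hac hP', Measure.rnDeriv_pos hac, hac (Measure.rnDeriv_lt_top
    (Q : Measure unitInterval) (P : Measure unitInterval))] with x hx hpos hlt
  rw [← Real.log_inv]
  exact Real.log_le_log (ENNReal.toReal_pos hpos.ne' hlt.ne) hx

/-- Reweighting `Q` by `g` and putting the missing mass at `0` gives a law of the null class. -/
lemma klInf_le_of_density {m : ℝ} {Q : Law} {g : unitInterval → ℝ} (hg : Continuous g)
    (hg0 : ∀ x, 0 < g x) (h1 : ∫ x, g x ∂(Q : Measure unitInterval) ≤ 1)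
    (hm : ∫ x, (x : ℝ) * g x ∂(Q : Measure unitInterval) ≤ m) :
    klInf Q m ≤ ENNReal.ofReal (∫ x, -Real.log (g x) ∂(Q : Measure unitInterval)) := by
  set μ := (Q : Measure unitInterval).withDensity (fun x => ENNReal.ofReal (g x)) with hμ
  have hgm : Measurable fun x => ENNReal.ofReal (g x) := hg.measurable.ennreal_ofReal
  have hμ1 : μ Set.univ ≤ 1 := by
    rw [hμ, withDensity_apply _ MeasurableSet.univ, Measure.restrict_univ,
      ← ofReal_integral_eq_lintegral_ofReal (integrable_of_continuous hg Q)
        (Eventually.of_forall fun x => (hg0 x).le)]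
    exact ENNReal.ofReal_le_one.2 h1
  set c := 1 - μ Set.univ
  let P' : Measure unitInterval := μ + c • Measure.dirac 0
  have hP1 : IsProbabilityMeasure P' := ⟨by
    simp [P', c, add_tsub_cancel_of_le hμ1]⟩
  let P : Law := ⟨P', hP1⟩
  have hle : μ ≤ P' := Measure.le_add_right le_rfl
  have hfin : IsFiniteMeasure μ := ⟨hμ1.trans_lt ENNReal.one_lt_top⟩
  have hc : c ≠ ⊤ := ENNReal.sub_ne_top ENNReal.one_ne_top
  have hPm : P ∈ preClass m := by
    have hx : Continuous fun x : unitInterval => (x : ℝ) := continuous_subtype_val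
    have hi : Integrable (fun x : unitInterval => (x : ℝ)) P' := integrable_of_continuous hx P
    have e1 : mean P = ∫ x, (x : ℝ) ∂μ := by
      change ∫ x, (x : ℝ) ∂P' = _
      rw [integral_add_measure (hi.mono_measure hle)
        (hi.mono_measure (Measure.le_add_left le_rfl)), integral_smul_measure, integral_dirac]
      simp
    change mean P ≤ m
    rw [e1, hμ, integral_withDensity_eq_integral_toReal_smul hgm
      (Eventually.of_forall fun x => ENNReal.ofReal_lt_top)]
    refine le_of_eq_of_le (integral_congr_ae (Eventually.of_forall fun x => ?_)) hm
    simp only [smul_eq_mul, ENNReal.toReal_ofReal (hg0 x).le]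
    ring
  exact (iInf₂_le P hPm).trans (klDiv_le_of_withDensity_le hg hg0 hle)

end Divergence

section Growth

variable {m l : ℝ}

/-- The growth rate `E_Q[log L_l(X)]` of the wealth process with betting fraction `l`. -/
noncomputable def growth (m : ℝ) (Q : Law) (l : ℝ) : ℝ :=
  ∫ x, Real.log (bet m l x) ∂(Q : Measure unitInterval)

lemma continuous_log_bet (hm0 : 0 < m) (hl0 : 0 ≤ l) (hl1 : l < 1) :
    Continuous fun x : unitInterval => Real.log (bet m l x) :=
  (continuous_bet m l).log fun x => (bet_pos hm0 hl0 hl1 x).ne'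

/-- `E_Q[1 / L_l(X)]`, the mass of the reweighted law `L_l⁻¹ Q`. -/
noncomputable def invMass (m : ℝ) (Q : Law) (l : ℝ) : ℝ :=
  ∫ x, (bet m l x)⁻¹ ∂(Q : Measure unitInterval)

lemma continuous_bet_inv (hm0 : 0 < m) (hl0 : 0 ≤ l) (hl1 : l < 1) :
    Continuous fun x : unitInterval => (bet m l x)⁻¹ :=
  (continuous_bet m l).inv₀ fun x => (bet_pos hm0 hl0 hl1 x).ne'

/-- The first moment of `L_l⁻¹ Q` is determined by its mass, since `l x / m = L_l(x) - (1 - l)`. -/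
lemma integral_mul_bet_inv (hm0 : 0 < m) (hl0 : 0 < l) (hl1 : l < 1) (Q : Law) :
    ∫ x, (x : ℝ) * (bet m l x)⁻¹ ∂(Q : Measure unitInterval)
      = m / l * (1 - (1 - l) * invMass m Q l) := by
  have h : ∀ x : unitInterval, (x : ℝ) * (bet m l x)⁻¹
      = m / l * (1 - (1 - l) * (bet m l x)⁻¹) := by
    intro x
    have hb := (bet_pos hm0 hl0.le hl1 x).ne'
    field_simp
    simp only [bet]
    field_simp
    ring
  simp_rw [h]
  rw [integral_const_mul, integral_sub (integrable_const _)
    ((integrable_of_continuous (continuous_bet_inv hm0 hl0.le hl1) Q).const_mul _),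
    integral_const_mul, invMass]
  simp

lemma invMass_nonneg (hm0 : 0 < m) (hl0 : 0 ≤ l) (hl1 : l < 1) (Q : Law) : 0 ≤ invMass m Q l :=
  integral_nonneg fun x => inv_nonneg.2 (bet_pos hm0 hl0 hl1 x).le

/-- When `L_l⁻¹ Q` has mass at most one, shrinking it by the factor `l` makes it feasible. -/
lemma klInf_le_of_invMass_le_one (hm0 : 0 < m) (hl0 : 0 < l) (hl1 : l < 1) {Q : Law}
    (h : invMass m Q l ≤ 1) : klInf Q m ≤ ENNReal.ofReal (growth m Q l - Real.log l) := by
  have hb := fun x => bet_pos (l := l) hm0 hl0.le hl1 x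
  have hc := continuous_bet_inv hm0 hl0.le hl1
  refine (klInf_le_of_density (m := m) (g := fun x => l * (bet m l x)⁻¹) (by fun_prop)
    (fun x => mul_pos hl0 (inv_pos.2 (hb x))) ?_ ?_).trans
    (ENNReal.ofReal_le_ofReal (le_of_eq ?_))
  · rw [integral_const_mul]
    exact (mul_le_mul_of_nonneg_left h hl0.le).trans (by linarith)
  · have e : ∀ x : unitInterval, (x : ℝ) * (l * (bet m l x)⁻¹)
        = l * ((x : ℝ) * (bet m l x)⁻¹) := fun x => by ring
    simp_rw [e]
    rw [integral_const_mul, integral_mul_bet_inv hm0 hl0 hl1, ← mul_assoc,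
      mul_div_cancel₀ _ hl0.ne']
    have := mul_nonneg (sub_nonneg.2 hl1.le) (invMass_nonneg hm0 hl0.le hl1 Q)
    exact mul_le_of_le_one_right hm0.le (by linarith)
  · have e : ∀ x : unitInterval, -Real.log (l * (bet m l x)⁻¹)
        = Real.log (bet m l x) - Real.log l := fun x => by
      rw [Real.log_mul hl0.ne' (inv_pos.2 (hb x)).ne', Real.log_inv]
      ring
    simp_rw [e]
    rw [integral_sub (integrable_of_continuous (continuous_log_bet hm0 hl0.le hl1) Q)
      (integrable_const _), growth]
    simp

/-- When `L_l⁻¹ Q` is a probability law, its mean is exactly `m`. -/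
lemma klInf_le_of_invMass_eq_one (hm0 : 0 < m) (hl0 : 0 < l) (hl1 : l < 1) {Q : Law}
    (h : invMass m Q l = 1) : klInf Q m ≤ ENNReal.ofReal (growth m Q l) := by
  have hb := fun x => bet_pos (l := l) hm0 hl0.le hl1 x
  refine (klInf_le_of_density (m := m) (continuous_bet_inv hm0 hl0.le hl1)
    (fun x => inv_pos.2 (hb x)) h.le ?_).trans (ENNReal.ofReal_le_ofReal (le_of_eq ?_))
  · rw [integral_mul_bet_inv hm0 hl0 hl1, h]
    refine le_of_eq ?_
    field_simp
    ring
  · simp_rw [Real.log_inv, neg_neg]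
    rfl

lemma abs_bet_sub_one_le (hm0 : 0 < m) (hm1 : m < 1) (hl0 : 0 ≤ l) (x : unitInterval) :
    |bet m l x - 1| ≤ l / m := by
  have h1 : 0 ≤ l / m * (x : ℝ) := mul_nonneg (div_nonneg hl0 hm0.le) x.2.1
  have h2 : l / m * (x : ℝ) ≤ l / m := mul_le_of_le_one_right (div_nonneg hl0 hm0.le) x.2.2
  have h3 : l ≤ l / m := le_div_self hl0 hm0 hm1.le
  unfold bet
  rw [abs_le]
  constructor <;> linarith

/-- Small bets on a favourable game: the first-order gain dominates the second-order loss. -/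
lemma invMass_le (hm0 : 0 < m) (hm1 : m < 1) (hl0 : 0 ≤ l) (hl : l / m ≤ 1 / 2) (Q : Law) :
    invMass m Q l ≤ 1 - l * (mean Q / m - 1) + 2 * (l / m) ^ 2 := by
  have hl1 : l < 1 := by
    have := le_div_self hl0 hm0 hm1.le
    linarith
  have hb : ∀ x : unitInterval, (bet m l x)⁻¹ ≤ 2 - bet m l x + 2 * (l / m) ^ 2 := by
    intro x
    have h1 := abs_le.1 (abs_bet_sub_one_le (l := l) hm0 hm1 hl0 x)
    have h2 : 0 < bet m l x := by linarith
    have h3 : (bet m l x - 1) ^ 2 ≤ (l / m) ^ 2 := sq_le_sq' h1.1 h1.2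
    have h4 : (1 : ℝ) / 2 ≤ bet m l x := by linarith
    rw [inv_eq_one_div, div_le_iff₀ h2]
    nlinarith [sq_nonneg (l / m)]
  calc invMass m Q l ≤ ∫ x, (2 - bet m l x + 2 * (l / m) ^ 2) ∂(Q : Measure unitInterval) :=
        integral_mono (integrable_of_continuous (continuous_bet_inv hm0 hl0 hl1) Q)
          (integrable_of_continuous (by fun_prop) Q) hb
    _ = _ := by
        rw [integral_add (integrable_of_continuous (by fun_prop) Q) (integrable_const _),
          integral_sub (integrable_const _) (integrable_of_continuous (continuous_bet m l) Q),
          integral_bet]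
        simp only [integral_const, probReal_univ, one_smul]
        ring

lemma le_growth (hm0 : 0 < m) (hm1 : m < 1) (hl0 : 0 ≤ l) (hl : l / m ≤ 1 / 2) (Q : Law) :
    l * (mean Q / m - 1) - 2 * (l / m) ^ 2 ≤ growth m Q l := by
  have hl1 : l < 1 := by
    have := le_div_self hl0 hm0 hm1.le
    linarith
  have hlog : 1 - invMass m Q l ≤ growth m Q l := by
    have e : 1 - invMass m Q l = ∫ x, (1 - (bet m l x)⁻¹) ∂(Q : Measure unitInterval) := by
      rw [integral_sub (integrable_const _)
        (integrable_of_continuous (continuous_bet_inv hm0 hl0 hl1) Q), invMass]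
      simp
    rw [e]
    exact integral_mono
      (integrable_of_continuous (continuous_const.sub (continuous_bet_inv hm0 hl0 hl1)) Q)
      (integrable_of_continuous (continuous_log_bet hm0 hl0 hl1) Q)
      fun x => Real.one_sub_inv_le_log_of_pos (bet_pos hm0 hl0 hl1 x)
  linarith [invMass_le hm0 hm1 hl0 hl Q]

lemma continuousOn_invMass (hm0 : 0 < m) (Q : Law) {b : ℝ} (hb : b < 1) :
    ContinuousOn (invMass m Q) (Set.Icc 0 b) := by
  refine continuousOn_of_dominated (bound := fun _ => (1 - b)⁻¹) ?_ ?_ (integrable_const _) ?_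
  · intro l hl
    exact (continuous_bet_inv hm0 hl.1 (hl.2.trans_lt hb)).aestronglyMeasurable
  · intro l hl
    refine Eventually.of_forall fun x => ?_
    have h1 := bet_pos hm0 hl.1 (hl.2.trans_lt hb) x
    rw [Real.norm_of_nonneg (inv_nonneg.2 h1.le)]
    exact inv_anti₀ (by linarith) (by linarith [bet_ge hm0 hl.1 x, hl.2])
  · refine Eventually.of_forall fun x => ContinuousOn.inv₀ ?_ ?_
    · unfold bet; fun_prop
    · intro l hl
      exact (bet_pos hm0 hl.1 (hl.2.trans_lt hb) x).ne'

/-- The dual bound: `KL_inf` is at most the supremum of the growth rates. Either the masses of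
`L_l⁻¹ Q` stay below one, and `l → 1` is used, or some `L_l⁻¹ Q` is a probability law. -/
lemma exists_klInf_le_growth (hm0 : 0 < m) (hm1 : m < 1) {Q : Law} (hQ : Q ∈ postClass m)
    {η : ℝ} (hη : 0 < η) :
    ∃ l ∈ Set.Ioo (0 : ℝ) 1, klInf Q m ≤ ENNReal.ofReal (growth m Q l + η) := by
  by_cases hA : ∀ l ∈ Set.Ioo (0 : ℝ) 1, invMass m Q l ≤ 1
  · have h1 : Real.exp (-η) < 1 := Real.exp_lt_one_iff.2 (by linarith)
    refine ⟨Real.exp (-η), ⟨Real.exp_pos _, h1⟩, ?_⟩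
    have := klInf_le_of_invMass_le_one hm0 (Real.exp_pos _) h1 (hA _ ⟨Real.exp_pos _, h1⟩)
    rwa [Real.log_exp, sub_neg_eq_add] at this
  · push Not at hA
    obtain ⟨b, ⟨hb0, hb1⟩, hb⟩ := hA
    -- for a small bet the mass is below one, so it equals one in between
    obtain ⟨a, ha0, hab, ha⟩ : ∃ a, 0 < a ∧ a ≤ b ∧ invMass m Q a ≤ 1 := by
      have hd : 0 < mean Q / m - 1 := by
        have : 1 < mean Q / m := (one_lt_div hm0).2 hQ
        linarith
      set d := mean Q / m - 1
      set a := min b (min (m / 2) (m ^ 2 * d / 2))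
      have ha0 : 0 < a := by positivity
      have h2 : a ≤ m / 2 := (min_le_right _ _).trans (min_le_left _ _)
      have h3 : a ≤ m ^ 2 * d / 2 := (min_le_right _ _).trans (min_le_right _ _)
      refine ⟨a, ha0, min_le_left _ _, ?_⟩
      refine (invMass_le hm0 hm1 ha0.le (by rw [div_le_iff₀ hm0]; linarith) Q).trans ?_
      have h4 : 2 * (a / m) ^ 2 ≤ a * d := by
        rw [div_pow, mul_div_assoc', div_le_iff₀ (by positivity)]
        nlinarith
      change 1 - a * d + 2 * (a / m) ^ 2 ≤ 1
      linarith
    obtain ⟨l, hl, hl1⟩ := intermediate_value_Icc hab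
      ((continuousOn_invMass hm0 Q hb1).mono (Set.Icc_subset_Icc_left ha0.le)) ⟨ha, hb.le⟩
    refine ⟨l, ⟨ha0.trans_le hl.1, hl.2.trans_lt hb1⟩, ?_⟩
    exact (klInf_le_of_invMass_eq_one hm0 (ha0.trans_le hl.1) (hl.2.trans_lt hb1) hl1).trans
      (ENNReal.ofReal_le_ofReal (by linarith))

lemma growth_mono_of_bet_le (hm0 : 0 < m) {l' c : ℝ} (hl0 : 0 ≤ l) (hl1 : l < 1)
    (hl0' : 0 ≤ l') (hl1' : l' < 1) (hc : 0 < c)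
    (h : ∀ x : unitInterval, c * bet m l x ≤ bet m l' x) (Q : Law) :
    growth m Q l + Real.log c ≤ growth m Q l' := by
  have hi := integrable_of_continuous (continuous_log_bet hm0 hl0 hl1) Q
  have e : growth m Q l + Real.log c
      = ∫ x, (Real.log (bet m l x) + Real.log c) ∂(Q : Measure unitInterval) := by
    rw [integral_add hi (integrable_const _), growth]
    simp
  rw [e]
  refine integral_mono (hi.add (integrable_const _))
    (integrable_of_continuous (continuous_log_bet hm0 hl0' hl1') Q) fun x => ?_
  have hb := bet_pos hm0 hl0 hl1 x
  change Real.log (bet m l x) + Real.log c ≤ _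
  rw [add_comm, ← Real.log_mul hc.ne' hb.ne']
  exact Real.log_le_log (mul_pos hc hb) (h x)

/-- Betting a little less costs at most the logarithm of the ratio of the fractions, because
`L_{c l} ≥ c L_l` for `c ≤ 1`; this is uniform up to `l = 1`. -/
lemma growth_of_le (hm0 : 0 < m) {l' : ℝ} (hl0' : 0 < l') (h : l' ≤ l) (hl1 : l < 1) (Q : Law) :
    growth m Q l + Real.log (l' / l) ≤ growth m Q l' := by
  have hl0 := hl0'.trans_le h
  refine growth_mono_of_bet_le hm0 hl0.le hl1 hl0'.le (h.trans_lt hl1) (by positivity)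
    (fun x => ?_) Q
  have e : l' / l * bet m l x = l' / l - l' + l' / m * x := by
    unfold bet; field_simp
  rw [e]
  have := (div_le_one hl0).2 h
  unfold bet
  linarith

/-- Betting more costs at most `-log (1 - l')`, because `L_{l'} ≥ (1 - l') L_l`. -/
lemma growth_of_ge (hm0 : 0 < m) {l' : ℝ} (hl0 : 0 ≤ l) (h : l ≤ l') (hl1' : l' < 1) (Q : Law) :
    growth m Q l + Real.log (1 - l') ≤ growth m Q l' := by
  refine growth_mono_of_bet_le hm0 hl0 (h.trans_lt hl1') (hl0.trans h) hl1' (by linarith)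
    (fun x => ?_) Q
  have h1 : (1 - l') * (l / m * x) ≤ l' / m * x := by
    have h2 : 0 ≤ l / m * (x : ℝ) := mul_nonneg (div_nonneg hl0 hm0.le) x.2.1
    have h3 : l / m * (x : ℝ) ≤ l' / m * x :=
      mul_le_mul_of_nonneg_right (div_le_div_of_nonneg_right h hm0.le) x.2.1
    nlinarith [hl0.trans h]
  have h4 : (1 - l') * (1 - l) ≤ 1 - l' := mul_le_of_le_one_right (by linarith) (by linarith)
  unfold bet
  linarith [mul_add (1 - l') (1 - l) (l / m * x)]

/-- Finitely many betting fractions from a dense set are as good as all of them up to `η`,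
uniformly in the law. -/
lemma exists_finset_growth (hm0 : 0 < m) {Λ : Set ℝ} (hΛs : Λ ⊆ Set.Ioo 0 1)
    (hΛd : Set.Ioo 0 1 ⊆ closure Λ) {η : ℝ} (hη : 0 < η) :
    ∃ F : Finset Λ, ∀ l ∈ Set.Ioo (0 : ℝ) 1, ∃ l' ∈ F, ∀ Q : Law,
      growth m Q l ≤ growth m Q l' + η := by
  have hdense : ∀ a b : ℝ, 0 ≤ a → b ≤ 1 → a < b → ∃ l' : Λ, a < (l' : ℝ) ∧ (l' : ℝ) < b := by
    intro a b ha hb hab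
    obtain ⟨y, hy, hyΛ⟩ := mem_closure_iff.1
      (hΛd (⟨by linarith, by linarith⟩ : (a + b) / 2 ∈ Set.Ioo (0 : ℝ) 1)) (Set.Ioo a b)
      isOpen_Ioo ⟨by linarith, by linarith⟩
    exact ⟨⟨y, hyΛ⟩, hy.1, hy.2⟩
  have he0 := Real.exp_pos (-η)
  have he1 : Real.exp (-η) < 1 := Real.exp_lt_one_iff.2 (by linarith)
  set q := Real.exp (-η) with hq
  have hlogq : Real.log q = -η := Real.log_exp _
  let U : Λ → Set ℝ := fun l' =>
    {l | l * q < l' ∧ (l' : ℝ) < l} ∪ {l | l < l' ∧ q < 1 - l'}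
  have hUo : ∀ l', IsOpen (U l') := by
    intro l'
    have h1 : IsOpen {l : ℝ | l * q < l'} := isOpen_lt (by fun_prop) continuous_const
    exact (h1.and isOpen_Ioi).union (isOpen_Iio.and isOpen_const)
  have hcov : Set.Icc (0 : ℝ) 1 ⊆ ⋃ l', U l' := by
    intro l hl
    rcases hl.1.eq_or_lt with rfl | h0
    · obtain ⟨l', h1, h2⟩ := hdense 0 (1 - q) le_rfl (by linarith) (by linarith)
      exact Set.mem_iUnion.2 ⟨l', Or.inr ⟨h1, by linarith⟩⟩
    · obtain ⟨l', h1, h2⟩ := hdense (l * q) l (by positivity) hl.2 (mul_lt_of_lt_one_right h0 he1)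
      exact Set.mem_iUnion.2 ⟨l', Or.inl ⟨h1, h2⟩⟩
  obtain ⟨F, hF⟩ := isCompact_Icc.elim_finite_subcover U hUo hcov
  refine ⟨F, fun l hl => ?_⟩
  obtain ⟨l', hl'F, hl'⟩ := Set.mem_iUnion₂.1 (hF (Set.Ioo_subset_Icc_self hl))
  refine ⟨l', hl'F, fun Q => ?_⟩
  have h0' := (hΛs l'.2).1
  have h1' := (hΛs l'.2).2
  rcases hl' with ⟨h1, h2⟩ | ⟨h1, h2⟩
  · have h3 := growth_of_le hm0 h0' h2.le hl.2 Q
    have h4 : -η ≤ Real.log (l' / l) := by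
      rw [← hlogq]
      exact Real.log_le_log he0 ((le_div_iff₀ hl.1).2 (by linarith [mul_comm l q]))
    linarith
  · have h3 := growth_of_ge hm0 hl.1.le h1.le h1' Q
    have h4 : -η ≤ Real.log (1 - l') := by
      rw [← hlogq]
      exact Real.log_le_log he0 h2.le
    linarith

/-- On a separated alternative class finitely many betting fractions suffice to attain `KL_inf` up
to a factor. A small fraction whose growth is bounded away from zero handles the laws with small
`KL_inf`; for the others an additive error is a relative one. -/
lemma exists_finset_klInf_le (hm0 : 0 < m) (hm1 : m < 1) {Λ : Set ℝ} (hΛs : Λ ⊆ Set.Ioo 0 1)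
    (hΛd : Set.Ioo 0 1 ⊆ closure Λ) {Δ ε : ℝ} (hΔ : 0 < Δ) (hε : 0 < ε) :
    ∃ F : Finset Λ, ∀ Q ∈ postClass (m + Δ), ∃ l ∈ F, 0 < growth m Q l ∧
      klInf Q m ≤ ENNReal.ofReal ((1 + ε) * growth m Q l) := by
  classical
  set d := Δ / m with hd
  have hd0 : 0 < d := by positivity
  obtain ⟨l₀, hl₀, hl₀Λ⟩ := mem_closure_iff.1
    (hΛd (⟨by positivity, (min_le_left _ _).trans_lt (by linarith)⟩ :
      min (m / 4) (m ^ 2 * d / 8) ∈ Set.Ioo (0 : ℝ) 1))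
    (Set.Ioo 0 (min (m / 2) (m ^ 2 * d / 4))) isOpen_Ioo
    ⟨by positivity, by
      refine lt_min ((min_le_left _ _).trans_lt (by linarith))
        ((min_le_right _ _).trans_lt ?_)
      have : 0 < m ^ 2 * d := by positivity
      linarith⟩
  have h0 : 0 < l₀ := hl₀.1
  have h1 : l₀ < m / 2 := hl₀.2.trans_le (min_le_left _ _)
  have h2 : l₀ < m ^ 2 * d / 4 := hl₀.2.trans_le (min_le_right _ _)
  set κ := l₀ * d / 2 with hκ
  have hκ0 : 0 < κ := by positivity
  have hgrow : ∀ Q ∈ postClass (m + Δ), κ ≤ growth m Q l₀ := by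
    intro Q hQ
    have h3 := le_growth hm0 hm1 h0.le (by rw [div_le_iff₀ hm0]; linarith) Q
    have h4 : d ≤ mean Q / m - 1 := by
      rw [hd, le_sub_iff_add_le, div_add_one hm0.ne']
      exact div_le_div_of_nonneg_right (by have : m + Δ < mean Q := hQ; linarith) hm0.le
    have h5 : l₀ * d ≤ l₀ * (mean Q / m - 1) := mul_le_mul_of_nonneg_left h4 h0.le
    have h6 : 2 * (l₀ / m) ^ 2 ≤ l₀ * d / 2 := by
      rw [div_pow, mul_div_assoc', div_le_iff₀ (by positivity)]
      nlinarith
    linarith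
  set η := κ * ε / (1 + ε) / 2 with hη
  have hη0 : 0 < η := by positivity
  have hη1 : (1 + ε) * (2 * η) = κ * ε := by rw [hη]; field_simp
  obtain ⟨F, hF⟩ := exists_finset_growth hm0 hΛs hΛd hη0
  refine ⟨insert ⟨l₀, hl₀Λ⟩ F, fun Q hQ => ?_⟩
  by_cases hk : klInf Q m ≤ ENNReal.ofReal κ
  · refine ⟨⟨l₀, hl₀Λ⟩, Finset.mem_insert_self _ _, hκ0.trans_le (hgrow Q hQ),
      hk.trans (ENNReal.ofReal_le_ofReal ?_)⟩
    change κ ≤ (1 + ε) * growth m Q l₀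
    have := hgrow Q hQ
    nlinarith
  · obtain ⟨l, hl, hle⟩ := exists_klInf_le_growth hm0 hm1
      (Q := Q) (show m < mean Q from (lt_add_of_pos_right m hΔ).trans hQ) hη0
    obtain ⟨l', hl'F, hl'⟩ := hF l hl
    have hb : klInf Q m ≤ ENNReal.ofReal (growth m Q l' + 2 * η) :=
      hle.trans (ENNReal.ofReal_le_ofReal (by linarith [hl' Q]))
    have hbig : κ < growth m Q l' + 2 * η := by
      by_contra! h
      exact hk (hb.trans (ENNReal.ofReal_le_ofReal h))
    have h3 : 2 * η ≤ ε * growth m Q l' := by nlinarith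
    refine ⟨l', Finset.mem_insert_of_mem hl'F, ?_, hb.trans (ENNReal.ofReal_le_ofReal (by linarith))⟩
    by_contra! h
    nlinarith

end Growth

/-! ### The delay bound -/

section Delay

variable {m : ℝ} {Λ : Set ℝ} {w : Λ → ℝ} {γ : ℝ}

lemma prod_bet_le_one_add_srStat {l : ℝ} (hm0 : 0 < m) (hl0 : 0 ≤ l) (hl1 : l ≤ 1) {k n : ℕ}
    (h : k ≤ n) (ω : Path) : ∏ i ∈ Finset.Ico k n, bet m l (ω i) ≤ 1 + srStat m l n ω := by
  induction n, h using Nat.le_induction with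
  | base => simpa using srStat_nonneg hm0 hl0 hl1 k ω
  | succ n h ih =>
    rw [Finset.prod_Ico_succ_top h, srStat_succ, mul_comm]
    have := mul_le_mul_of_nonneg_left ih (bet_nonneg hm0 hl0 hl1 (ω n))
    linarith

lemma prod_bet_le_srStat {l : ℝ} (hm0 : 0 < m) (hl0 : 0 ≤ l) (hl1 : l ≤ 1) {k n : ℕ}
    (h : k < n) (ω : Path) : ∏ i ∈ Finset.Ico k n, bet m l (ω i) ≤ srStat m l n ω := by
  obtain ⟨n, rfl⟩ : ∃ j, n = j + 1 := ⟨n - 1, by omega⟩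
  rw [Finset.prod_Ico_succ_top (by omega), srStat_succ, mul_comm]
  exact mul_le_mul_of_nonneg_left (prod_bet_le_one_add_srStat hm0 hl0 hl1 (by omega) ω)
    (bet_nonneg hm0 hl0 hl1 (ω n))

/-- Before the alarm, the log-wealth accumulated since any starting time is below the threshold. -/
lemma sum_log_bet_le (hm0 : 0 < m) (hm1 : m < 1) (hΛs : Λ ⊆ Set.Ioo 0 1) (hw0 : ∀ l, 0 < w l)
    (hw1 : HasSum w 1) (hγ : 1 ≤ γ) (l : Λ) {k n : ℕ} (h : k ≤ n) {ω : Path}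
    (hω : ω ∈ survive m Λ w γ n) :
    ∑ i ∈ Finset.Ico k n, Real.log (bet m l (ω i)) ≤ Real.log γ - Real.log (w l) := by
  have h0 := (hΛs l.2).1.le
  have h1 := (hΛs l.2).2
  rcases h.eq_or_lt with rfl | h
  · have hw : w l ≤ 1 := le_hasSum hw1 l fun j _ => (hw0 j).le
    have := Real.log_nonpos (hw0 l).le hw
    have := Real.log_nonneg hγ
    simp only [Finset.Ico_self, Finset.sum_empty]
    linarith
  · have hb : ∀ i, 0 < bet m l (ω i) := fun i => bet_pos hm0 h0 h1 _
    rw [← Real.log_prod fun i _ => (hb i).ne', le_sub_iff_add_le, add_comm,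
      ← Real.log_mul (hw0 l).ne' (Finset.prod_pos fun i _ => hb i).ne']
    refine Real.log_le_log (mul_pos (hw0 l) (Finset.prod_pos fun i _ => hb i)) ?_
    calc w l * ∏ i ∈ Finset.Ico k n, bet m l (ω i) ≤ w l * srStat m l n ω :=
          mul_le_mul_of_nonneg_left (prod_bet_le_srStat hm0 h0 h1.le h ω) (hw0 l).le
      _ ≤ mixStat m Λ w n ω :=
          (summable_mixStat hm0 hm1 hΛs hw0 hw1 n ω).le_tsum l fun j _ => mul_nonneg (hw0 j).le
            (srStat_nonneg hm0 (hΛs j.2).1.le (hΛs j.2).2.le n ω)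
      _ ≤ γ := (mixStat_lt_of_mem_survive (by omega) hω).le

/-- Wald's argument from the change time on: on the event of no alarm the distance of the
log-wealth to the highest level it can reach stays nonnegative, and it shrinks on average by the
growth rate with each observation. -/
lemma tsum_survive_le (hm0 : 0 < m) (hm1 : m < 1) (hΛc : Λ.Countable) (hΛs : Λ ⊆ Set.Ioo 0 1)
    (hw0 : ∀ l, 0 < w l) (hw1 : HasSum w 1) (hγ : 1 ≤ γ) (l : Λ) {Q : Law}
    (hQ : 0 < growth m Q l) (ν : ℕ → Measure unitInterval) [∀ i, IsProbabilityMeasure (ν i)]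
    (k : ℕ) (hν : ∀ i, k ≤ i → ν i = Q) :
    ∑' j : ℕ, Measure.infinitePi ν (survive m Λ w γ (k + j))
      ≤ ENNReal.ofReal ((Real.log γ + (-Real.log (w l) - Real.log m)) / growth m Q l)
        * Measure.infinitePi ν (survive m Λ w γ k) := by
  have h0 := (hΛs l.2).1.le
  have h1 := (hΛs l.2).2
  set μ := Measure.infinitePi ν
  set s := survive m Λ w γ
  set D := Real.log γ + (-Real.log (w l) - Real.log m) with hD
  set f := growth m Q l with hf
  have hs : ∀ n, MeasurableSet (s n) := fun n => past_le n _ (measurableSet_survive hΛc n)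
  let Y : unitInterval → ℝ := fun x => Real.log (bet m l x)
  have hYc : Continuous Y := continuous_log_bet hm0 h0 h1
  obtain ⟨K, hK⟩ := isCompact_univ.exists_bound_of_continuousOn hYc.continuousOn
  have hYle : ∀ x, Y x ≤ -Real.log m := fun x => by
    rw [← Real.log_inv, ← one_div]
    exact Real.log_le_log (bet_pos hm0 h0 h1 x) (bet_le hm0 hm1.le h0 h1.le x)
  have hYi : ∀ i, Integrable (fun ω : Path => Y (ω i)) μ := fun i =>
    Integrable.of_bound (C := K) (hYc.measurable.comp (measurable_pi_apply i)).aestronglyMeasurable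
      (Eventually.of_forall fun ω => hK _ trivial)
  let V : ℕ → Path → ℝ := fun n ω => ∑ i ∈ Finset.Ico k n, Y (ω i)
  have hVi : ∀ n, Integrable (V n) μ := fun n => integrable_finsetSum _ fun i _ => hYi i
  have hDV : ∀ n, Integrable (fun ω => D - V n ω) μ := fun n => (integrable_const D).sub (hVi n)
  have hlogm : 0 ≤ -Real.log m := neg_nonneg.2 (Real.log_nonpos hm0.le hm1.le)
  have hV : ∀ n, k ≤ n → ∀ ω ∈ s n, V n ω ≤ D + Real.log m := fun n hn ω hω => by
    have := sum_log_bet_le hm0 hm1 hΛs hw0 hw1 hγ l hn hω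
    change V n ω ≤ _ at this
    linarith
  let a : ℕ → ℝ := fun n => ∫ ω in s n, (D - V n ω) ∂μ
  have ha0 : ∀ n, k ≤ n → 0 ≤ a n := fun n hn =>
    setIntegral_nonneg (hs n) fun ω hω => by linarith [hV n hn ω hω]
  have hstep : ∀ n, k ≤ n → a (n + 1) + f * μ.real (s n) ≤ a n := by
    intro n hn
    have e : ∀ ω, D - V (n + 1) ω = (D - V n ω) - Y (ω n) := fun ω => by
      simp only [V, Finset.sum_Ico_succ_top hn]
      ring
    have h2 : a (n + 1) ≤ ∫ ω in s n, (D - V (n + 1) ω) ∂μ := by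
      refine setIntegral_mono_set (hDV (n + 1)).integrableOn ?_
        (survive_antitone n.le_succ).eventuallyLE
      filter_upwards [ae_restrict_mem (hs n)] with ω hω
      rw [e]
      have := hV n hn ω hω
      have := hYle (ω n)
      change 0 ≤ _
      linarith
    have h3 : ∫ ω in s n, (D - V (n + 1) ω) ∂μ = a n - f * μ.real (s n) := by
      simp_rw [e]
      rw [integral_sub (hDV n).integrableOn (hYi n).integrableOn,
        setIntegral_past_eval ν (measurableSet_survive hΛc n) hYc.measurable, hν n hn, mul_comm f]
      rfl
    linarith
  have hsum : ∀ N, a (k + N) + f * ∑ j ∈ Finset.range N, μ.real (s (k + j)) ≤ a k := by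
    intro N
    induction N with
    | zero => simp
    | succ N ih =>
      rw [Finset.sum_range_succ, mul_add]
      have : a (k + (N + 1)) + f * μ.real (s (k + N)) ≤ a (k + N) := hstep (k + N) (by omega)
      linarith
  have hak : a k = D * μ.real (s k) := by
    simp [a, V, mul_comm]
  refine ENNReal.tsum_le_of_sum_range_le fun N => ?_
  have h4 : ∑ j ∈ Finset.range N, μ.real (s (k + j)) ≤ D / f * μ.real (s k) := by
    have := hsum N
    have := ha0 (k + N) (by omega)
    rw [div_mul_eq_mul_div, le_div_iff₀ hQ, ← hak]
    linarith
  have hD0 : 0 ≤ D / f := by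
    have hw : w l ≤ 1 := le_hasSum hw1 l fun j _ => (hw0 j).le
    have := Real.log_nonpos (hw0 l).le hw
    have := Real.log_nonneg hγ
    exact div_nonneg (by linarith) hQ.le
  calc ∑ j ∈ Finset.range N, μ (s (k + j))
      = ENNReal.ofReal (∑ j ∈ Finset.range N, μ.real (s (k + j))) := by
        rw [ENNReal.ofReal_sum_of_nonneg fun _ _ => measureReal_nonneg]
        exact Finset.sum_congr rfl fun j _ => (ofReal_measureReal).symm
    _ ≤ ENNReal.ofReal (D / f * μ.real (s k)) := ENNReal.ofReal_le_ofReal h4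
    _ = _ := by rw [ENNReal.ofReal_mul hD0, ofReal_measureReal]

lemma delayAt_succ_eq_tsum (hΛc : Λ.Countable) (P Q : Law) (k : ℕ) :
    delayAt P Q (k + 1) (detector m Λ w γ)
      = ∑' j : ℕ, cond (changeAt P Q (k + 1)) (survive m Λ w γ k) (survive m Λ w γ (k + j)) := by
  rw [← lintegral_detector_sub hΛc]
  have hset : {ω | ((k + 1 : ℕ) : ℕ∞) ≤ detector m Λ w γ ω} = survive m Λ w γ k := by
    ext ω
    simp only [survive, Set.mem_ofPred_eq, Nat.cast_add, Nat.cast_one,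
      ENat.add_one_le_iff (ENat.natCast_ne_top k)]
  unfold delayAt
  rw [hset]
  refine lintegral_congr fun ω => ?_
  push_cast
  rw [add_comm (k : ℝ≥0∞) 1, ← tsub_tsub, ENNReal.add_sub_cancel_right ENNReal.one_ne_top]

/-- The delay bound for the detector, from any one of its betting fractions, uniform in the
pre-change laws. -/
theorem cadd_detector_le (hm0 : 0 < m) (hm1 : m < 1) (hΛc : Λ.Countable) (hΛs : Λ ⊆ Set.Ioo 0 1)
    (hw0 : ∀ l, 0 < w l) (hw1 : HasSum w 1) (hγ : 1 ≤ γ) (l : Λ) {Q : Law}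
    (hQ : 0 < growth m Q l) (S : Set Law) :
    cadd S Q (detector m Λ w γ)
      ≤ ENNReal.ofReal ((Real.log γ + (-Real.log (w l) - Real.log m)) / growth m Q l) := by
  refine iSup₂_le fun P _ => iSup₂_le fun k hk => ?_
  obtain ⟨k, rfl⟩ : ∃ j, k = j + 1 := ⟨k - 1, by omega⟩
  rw [delayAt_succ_eq_tsum hΛc]
  set B := ENNReal.ofReal ((Real.log γ + (-Real.log (w l) - Real.log m)) / growth m Q l)
  set μ := changeAt P Q (k + 1) with hμ
  have hs : ∀ n, MeasurableSet (survive m Λ w γ n) := fun n =>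
    past_le n _ (measurableSet_survive hΛc n)
  have h1 : ∑' j : ℕ, μ (survive m Λ w γ (k + j)) ≤ B * μ (survive m Λ w γ k) :=
    tsum_survive_le hm0 hm1 hΛc hΛs hw0 hw1 hγ l hQ _ k fun i hi => by
      rw [if_neg (by omega)]
  calc ∑' j : ℕ, cond μ (survive m Λ w γ k) (survive m Λ w γ (k + j))
      = (μ (survive m Λ w γ k))⁻¹ * ∑' j : ℕ, μ (survive m Λ w γ (k + j)) := by
        rw [← ENNReal.tsum_mul_left]
        refine tsum_congr fun j => ?_
        rw [cond_apply (hs k), Set.inter_eq_self_of_subset_right (survive_antitone (by omega))]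
    _ ≤ (μ (survive m Λ w γ k))⁻¹ * (B * μ (survive m Λ w γ k)) := mul_le_mul_right h1 _
    _ = B * ((μ (survive m Λ w γ k))⁻¹ * μ (survive m Λ w γ k)) := by ring
    _ ≤ B := mul_le_of_le_one_right zero_le (ENNReal.inv_mul_le_one _)

end Delay

/-! ### The lower bound on the delay -/

section LowerBound

variable {m : ℝ} {Λ : Set ℝ} {w : Λ → ℝ}

/-- The likelihood ratio of `Q` against `P` grows at rate `KL(Q ‖ P)`: exceeding any larger rate
has vanishing probability. -/
lemma tendsto_likelihood_ratio_exceeds {P Q : Law} {K : ℝ}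
    (hK : InformationTheory.klDiv (Q : Measure unitInterval) (P : Measure unitInterval)
      < ENNReal.ofReal K) :
    Tendsto (fun n : ℕ => noChange Q {ω | ENNReal.ofReal (Real.exp (K * n))
      < ∏ i ∈ Finset.range n, (Q : Measure unitInterval).rnDeriv (P : Measure unitInterval) (ω i)})
      atTop (𝓝 0) := by
  obtain ⟨hac, hint⟩ := InformationTheory.klDiv_ne_top_iff.1 (ne_top_of_lt hK)
  have hmeas := measurable_llr (Q : Measure unitInterval) (P : Measure unitInterval)
  have hh := Measure.measurable_rnDeriv (Q : Measure unitInterval) (P : Measure unitInterval)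
  have hmean : ∫ x, llr (Q : Measure unitInterval) (P : Measure unitInterval) x
      ∂(Q : Measure unitInterval) < K := by
    rw [← InformationTheory.toReal_klDiv_of_measure_eq hac (by simp)]
    exact (ENNReal.lt_ofReal_iff_toReal_lt (ne_top_of_lt hK)).1 hK
  have hpos : ∀ᵐ x ∂(Q : Measure unitInterval),
      (Q : Measure unitInterval).rnDeriv (P : Measure unitInterval) x = ENNReal.ofReal (Real.exp
        (llr (Q : Measure unitInterval) (P : Measure unitInterval) x)) := by
    filter_upwards [Measure.rnDeriv_pos hac, hac (Measure.rnDeriv_lt_top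
      (Q : Measure unitInterval) (P : Measure unitInterval))] with x h1 h2
    rw [llr, Real.exp_log (ENNReal.toReal_pos h1.ne' h2.ne), ENNReal.ofReal_toReal h2.ne]
  set h := (Q : Measure unitInterval).rnDeriv (P : Measure unitInterval)
  set L := llr (Q : Measure unitInterval) (P : Measure unitInterval)
  have hmp : ∀ i : ℕ, MeasurePreserving (fun ω : Path => ω i) (noChange Q)
      (Q : Measure unitInterval) := fun i =>
    measurePreserving_eval_infinitePi (fun _ : ℕ => (Q : Measure unitInterval)) i
  have hpos' : ∀ᵐ ω ∂(noChange Q), ∀ i : ℕ, h (ω i) = ENNReal.ofReal (Real.exp (L (ω i))) :=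
    ae_all_iff.2 fun i => (hmp i).quasiMeasurePreserving.ae hpos
  have hslln := strong_law_ae_real (μ := noChange Q) (fun i ω => L (ω i))
    ((hmp 0).integrable_comp_of_integrable hint)
    (fun i j hij => (iIndepFun_infinitePi (P := fun _ : ℕ => (Q : Measure unitInterval))
      (X := fun _ => L) fun _ => hmeas).indepFun hij)
    (fun i => ⟨(hmeas.comp (measurable_pi_apply i)).aemeasurable,
      (hmeas.comp (measurable_pi_apply 0)).aemeasurable, by
        have h1 := Measure.map_map (μ := noChange Q) hmeas (hmp i).measurable
        have h2 := Measure.map_map (μ := noChange Q) hmeas (hmp 0).measurable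
        rw [(hmp i).map_eq] at h1
        rw [(hmp 0).map_eq] at h2
        exact h1.symm.trans h2⟩)
  have hmean' : ∫ ω, L (ω 0) ∂(noChange Q) < K := by
    rw [← (hmp 0).map_eq, integral_map (hmp 0).measurable.aemeasurable
      hmeas.aestronglyMeasurable] at hmean
    exact hmean
  rw [← measure_empty (μ := noChange Q)]
  refine tendsto_measure_of_ae_tendsto_indicator_of_isFiniteMeasure _ MeasurableSet.empty
    (fun n => measurableSet_lt measurable_const (Finset.measurable_prod _ fun i _ =>
      hh.comp (measurable_pi_apply i))) ?_
  filter_upwards [hslln, hpos'] with ω h1 h2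
  filter_upwards [h1.eventually_lt_const hmean', eventually_gt_atTop 0] with n h3 h4
  simp only [Set.mem_empty_iff_false, iff_false, not_lt]
  have h5 : (0 : ℝ) < n := by exact_mod_cast h4
  rw [Finset.prod_congr rfl fun i _ => h2 i, ← ENNReal.ofReal_prod_of_nonneg
    fun i _ => (Real.exp_pos _).le, ← Real.exp_sum]
  refine ENNReal.ofReal_le_ofReal (Real.exp_le_exp.2 ?_)
  exact ((div_lt_iff₀ h5).1 h3).le

/-- Under any `Q`, an alarm within `n` observations is an alarm with small likelihood ratio, which
the false-alarm bound under `P` controls, or the likelihood ratio is large. -/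
lemma noChange_compl_survive_le (hm0 : 0 < m) (hm1 : m < 1) (hΛc : Λ.Countable)
    (hΛs : Λ ⊆ Set.Ioo 0 1) (hw0 : ∀ l, 0 < w l) (hw1 : HasSum w 1) {P Q : Law}
    (hP : P ∈ preClass m) (hac : (Q : Measure unitInterval) ≪ (P : Measure unitInterval))
    {γ : ℝ} (hγ : 0 < γ) (n : ℕ) (c : ℝ≥0∞) :
    noChange Q (survive m Λ w γ n)ᶜ ≤ c * (n / ENNReal.ofReal γ)
      + noChange Q {ω | c < ∏ i ∈ Finset.range n,
          (Q : Measure unitInterval).rnDeriv (P : Measure unitInterval) (ω i)} := by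
  have hh := Measure.measurable_rnDeriv (Q : Measure unitInterval) (P : Measure unitInterval)
  have hQ := Measure.withDensity_rnDeriv_eq _ _ hac
  set h := (Q : Measure unitInterval).rnDeriv (P : Measure unitInterval)
  set A := {ω : Path | c < ∏ i ∈ Finset.range n, h (ω i)}
  have hA : MeasurableSet[past n] A := by
    have hm : Measurable[past n] fun ω : Path => ∏ i ∈ Finset.range n, h (ω i) :=
      Finset.measurable_prod _ fun i hi =>
        hh.comp (measurable_past_eval (Finset.mem_range.1 hi))
    exact hm measurableSet_Ioi
  have hs : MeasurableSet[past n] (survive m Λ w γ n) := measurableSet_survive hΛc n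
  have hfalse : noChange P (survive m Λ w γ n)ᶜ ≤ n / ENNReal.ofReal γ := by
    rw [ENNReal.le_div_iff_mul_le (Or.inl (ENNReal.ofReal_pos.2 hγ).ne')
      (Or.inl ENNReal.ofReal_ne_top), mul_comm]
    refine (mul_compl_survive_le hm0 hm1 hΛc hΛs hw0 hw1 hP n).trans ?_
    refine (Finset.sum_le_sum fun j _ => prob_le_one).trans ?_
    simp
  calc noChange Q (survive m Λ w γ n)ᶜ
      ≤ noChange Q (((survive m Λ w γ n)ᶜ \ A) ∪ A) :=
        measure_mono (by rw [Set.sdiff_union_self]; exact Set.subset_union_left)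
    _ ≤ noChange Q ((survive m Λ w γ n)ᶜ \ A) + noChange Q A := measure_union_le _ _
    _ ≤ c * noChange P ((survive m Λ w γ n)ᶜ \ A) + noChange Q A := by
        gcongr
        exact infinitePi_le_mul_of_density hh hQ
          (@MeasurableSet.diff _ (past n) _ _ (@MeasurableSet.compl _ _ (past n) hs) hA) c
          fun ω hω => not_lt.1 hω.2
    _ ≤ c * (n / ENNReal.ofReal γ) + noChange Q A := by
        gcongr
        exact (measure_mono Set.sdiff_subset).trans hfalse

lemma tendsto_noChange_compl_survive (hm0 : 0 < m) (hm1 : m < 1) (hΛc : Λ.Countable)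
    (hΛs : Λ ⊆ Set.Ioo 0 1) (hw0 : ∀ l, 0 < w l) (hw1 : HasSum w 1) {Q : Law} {K β : ℝ}
    (hK : klInf Q m < ENNReal.ofReal K) (hβ : 0 < β) (hβK : K * β < 1) :
    Tendsto (fun γ : ℝ => noChange Q (survive m Λ w γ ⌊β * Real.log γ⌋₊)ᶜ) atTop (𝓝 0) := by
  obtain ⟨P, hP, hPK⟩ : ∃ P ∈ preClass m, InformationTheory.klDiv (Q : Measure unitInterval)
      (P : Measure unitInterval) < ENNReal.ofReal K := by
    simpa [klInf, iInf_lt_iff] using hK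
  have hK0 : 0 < K := ENNReal.ofReal_pos.1 (zero_le.trans_lt hK)
  have hac := (InformationTheory.klDiv_ne_top_iff.1 (ne_top_of_lt hPK)).1
  have hN : Tendsto (fun γ : ℝ => ⌊β * Real.log γ⌋₊) atTop atTop :=
    tendsto_nat_floor_atTop.comp (Real.tendsto_log_atTop.const_mul_atTop hβ)
  have h2 := (tendsto_likelihood_ratio_exceeds hPK).comp hN
  have h1 : Tendsto (fun γ : ℝ => ENNReal.ofReal (Real.exp (K * ⌊β * Real.log γ⌋₊))
      * ((⌊β * Real.log γ⌋₊ : ℕ) / ENNReal.ofReal γ)) atTop (𝓝 0) := by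
    have h3 : Tendsto (fun γ : ℝ => ENNReal.ofReal (β * (Real.log γ ^ (1 : ℝ)
        * Real.exp (-(1 - K * β) * Real.log γ)))) atTop (𝓝 0) := by
      have := ((tendsto_rpow_mul_exp_neg_mul_atTop_nhds_zero 1 (1 - K * β) (by linarith)).comp
        Real.tendsto_log_atTop).const_mul β
      simpa using ENNReal.tendsto_ofReal this
    refine tendsto_of_tendsto_of_tendsto_of_le_of_le' tendsto_const_nhds h3
      (Eventually.of_forall fun _ => zero_le) ?_
    filter_upwards [eventually_ge_atTop 1] with γ hγ
    have hγ0 : 0 < γ := by linarith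
    have hl : 0 ≤ Real.log γ := Real.log_nonneg hγ
    have hfl : (⌊β * Real.log γ⌋₊ : ℝ) ≤ β * Real.log γ := Nat.floor_le (by positivity)
    rw [← ENNReal.ofReal_natCast, ← ENNReal.ofReal_div_of_pos hγ0,
      ← ENNReal.ofReal_mul (Real.exp_pos _).le]
    refine ENNReal.ofReal_le_ofReal ?_
    have e : β * (Real.log γ ^ (1 : ℝ) * Real.exp (-(1 - K * β) * Real.log γ))
        = Real.exp (K * (β * Real.log γ)) * (β * Real.log γ / γ) := by
      rw [Real.rpow_one, show -(1 - K * β) * Real.log γ = K * (β * Real.log γ) - Real.log γ by ring,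
        Real.exp_sub, Real.exp_log hγ0]
      ring
    rw [e]
    gcongr
  refine tendsto_of_tendsto_of_tendsto_of_le_of_le' tendsto_const_nhds
    (by simpa using h1.add h2) (Eventually.of_forall fun _ => zero_le) ?_
  filter_upwards [eventually_gt_atTop 0] with γ hγ
  exact noChange_compl_survive_le hm0 hm1 hΛc hΛs hw0 hw1 hP hac hγ _ _

lemma mul_survive_le_cadd (hΛc : Λ.Countable) {S : Set Law} (hS : S.Nonempty) (Q : Law) (γ : ℝ)
    (n : ℕ) :
    n * noChange Q (survive m Λ w γ n) ≤ cadd S Q (detector m Λ w γ) := by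
  obtain ⟨P, hP⟩ := hS
  have h1 : delayAt P Q (0 + 1) (detector m Λ w γ) ≤ cadd S Q (detector m Λ w γ) :=
    (le_iSup₂_of_le (f := fun k (_ : 1 ≤ k) => delayAt P Q k (detector m Λ w γ)) (0 + 1) le_rfl
      le_rfl).trans (le_iSup₂ (f := fun P (_ : P ∈ S) => ⨆ k : ℕ, ⨆ _ : 1 ≤ k,
        delayAt P Q k (detector m Λ w γ)) P hP)
  refine le_trans ?_ h1
  have h2 : changeAt P Q (0 + 1) = noChange Q := by
    simp [changeAt, noChange]
  rw [delayAt_succ_eq_tsum hΛc, h2, survive_zero, cond_univ]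
  refine le_trans ?_ (ENNReal.sum_le_tsum (Finset.range n))
  calc (n : ℝ≥0∞) * noChange Q (survive m Λ w γ n)
      = ∑ j ∈ Finset.range n, noChange Q (survive m Λ w γ n) := by simp
    _ ≤ _ := Finset.sum_le_sum fun j hj =>
        measure_mono (survive_antitone (by have := Finset.mem_range.1 hj; omega))

/-- The delay of the detector is asymptotically at least `log γ / KL_inf`. -/
theorem eventually_lt_cadd_div_log (hm0 : 0 < m) (hm1 : m < 1) (hΛc : Λ.Countable)
    (hΛs : Λ ⊆ Set.Ioo 0 1) (hw0 : ∀ l, 0 < w l) (hw1 : HasSum w 1) {S : Set Law}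
    (hS : S.Nonempty) {Q : Law} {a : ℝ≥0∞} (ha : a < 1 / klInf Q m) :
    ∀ᶠ γ : ℝ in atTop, a < cadd S Q (detector m Λ w γ) / ENNReal.ofReal (Real.log γ) := by
  -- choose `K > KL_inf` and `β > a` with `K β < 1`
  have ha' : klInf Q m < a⁻¹ := by
    rw [one_div] at ha
    exact ENNReal.lt_inv_iff_lt_inv.1 ha
  obtain ⟨K, hK1, hK2⟩ := exists_between ha'
  obtain ⟨b, hb1, hb2⟩ := exists_between (ENNReal.lt_inv_iff_lt_inv.1 hK2)
  have hKt : K ≠ ⊤ := ne_top_of_lt hK2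
  have hbt : b ≠ ⊤ := ne_top_of_lt hb2
  have hb0 : b ≠ 0 := (zero_le.trans_lt hb1).ne'
  have hKb : K.toReal * b.toReal < 1 := by
    rw [← ENNReal.toReal_mul, ← ENNReal.toReal_one]
    rw [mul_comm]
    refine (ENNReal.toReal_lt_toReal (ENNReal.mul_ne_top hbt hKt) ENNReal.one_ne_top).2 ?_
    exact ENNReal.mul_lt_of_lt_div (by rwa [one_div])
  have hβ : 0 < b.toReal := ENNReal.toReal_pos hb0 hbt
  have hlim := tendsto_noChange_compl_survive hm0 hm1 hΛc hΛs hw0 hw1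
    (K := K.toReal) (by rwa [ENNReal.ofReal_toReal hKt]) hβ hKb
  have h1 : Tendsto (fun γ : ℝ => noChange Q (survive m Λ w γ ⌊b.toReal * Real.log γ⌋₊))
      atTop (𝓝 1) := by
    have h2 := ENNReal.Tendsto.sub (tendsto_const_nhds (x := (1 : ℝ≥0∞))) hlim
      (Or.inl ENNReal.one_ne_top)
    rw [tsub_zero] at h2
    refine h2.congr fun γ => ?_
    rw [← prob_compl_eq_one_sub (past_le _ _ (measurableSet_survive hΛc _)).compl, compl_compl]
  have h3 : Tendsto (fun γ : ℝ => ENNReal.ofReal (⌊b.toReal * Real.log γ⌋₊ / Real.log γ))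
      atTop (𝓝 b) := by
    have := ENNReal.tendsto_ofReal
      ((tendsto_nat_floor_mul_div_atTop hβ.le).comp Real.tendsto_log_atTop)
    rwa [ENNReal.ofReal_toReal hbt] at this
  have h4 := ENNReal.Tendsto.mul h3 (Or.inr ENNReal.one_ne_top) h1 (Or.inr hbt)
  rw [mul_one] at h4
  filter_upwards [h4.eventually_const_lt hb1, eventually_gt_atTop 1] with γ h5 h6
  refine h5.trans_le ?_
  have hl : 0 < Real.log γ := Real.log_pos h6
  rw [ENNReal.ofReal_div_of_pos hl, ENNReal.ofReal_natCast, div_eq_mul_inv, mul_right_comm,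
    ← div_eq_mul_inv]
  gcongr
  exact mul_survive_le_cadd hΛc hS Q γ _

end LowerBound

/-! ### Asymptotic optimality -/

section Optimality

variable {m : ℝ} {Λ : Set ℝ} {w : Λ → ℝ}

/-- The normalised delay is at most `1 + o(1)`, uniformly over a separated alternative class and
over all sets of pre-change laws. -/
theorem eventually_klInf_mul_cadd_le (hm0 : 0 < m) (hm1 : m < 1) (hΛc : Λ.Countable)
    (hΛs : Λ ⊆ Set.Ioo 0 1) (hΛd : Set.Ioo 0 1 ⊆ closure Λ) (hw0 : ∀ l, 0 < w l)
    (hw1 : HasSum w 1) {Δ : ℝ} (hΔ : 0 < Δ) {c : ℝ≥0∞} (hc : 1 < c) :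
    ∀ᶠ γ : ℝ in atTop, ∀ Q ∈ postClass (m + Δ), ∀ S : Set Law,
      klInf Q m * cadd S Q (detector m Λ w γ) / ENNReal.ofReal (Real.log γ) ≤ c := by
  obtain ⟨ε, hεc, hε⟩ : ∃ ε : ℝ, ENNReal.ofReal ((1 + ε) ^ 2) < c ∧ 0 < ε := by
    have h1 : Tendsto (fun ε : ℝ => ENNReal.ofReal ((1 + ε) ^ 2)) (𝓝[>] 0) (𝓝 1) := by
      have h2 : Continuous fun ε : ℝ => ENNReal.ofReal ((1 + ε) ^ 2) :=
        ENNReal.continuous_ofReal.comp (by fun_prop)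
      have h3 := (h2.tendsto 0).mono_left (nhdsWithin_le_nhds (s := Set.Ioi 0))
      simpa using h3
    exact ((h1.eventually_lt_const hc).and self_mem_nhdsWithin).exists
  obtain ⟨F, hF⟩ := exists_finset_klInf_le hm0 hm1 hΛs hΛd hΔ hε
  have hlog : ∀ᶠ γ : ℝ in atTop, ∀ l ∈ F,
      (-Real.log (w l) - Real.log m) / ε ≤ Real.log γ :=
    (Filter.eventually_all_finset F).2 fun l _ => Real.tendsto_log_atTop.eventually_ge_atTop _
  filter_upwards [hlog, eventually_gt_atTop 1] with γ hγ hγ1 Q hQ S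
  obtain ⟨l, hl, hg, hle⟩ := hF Q hQ
  have hl0 : 0 < Real.log γ := Real.log_pos hγ1
  refine le_trans ?_ hεc.le
  rw [ENNReal.div_le_iff (ENNReal.ofReal_pos.2 hl0).ne' ENNReal.ofReal_ne_top,
    ← ENNReal.ofReal_mul (by positivity)]
  refine (mul_le_mul' hle (cadd_detector_le hm0 hm1 hΛc hΛs hw0 hw1 hγ1.le l hg S)).trans ?_
  rw [← ENNReal.ofReal_mul (by positivity)]
  refine ENNReal.ofReal_le_ofReal ?_
  have h1 := (div_le_iff₀ hε).1 (hγ l hl)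
  rw [mul_assoc, mul_div_cancel₀ _ hg.ne', sq, mul_assoc]
  gcongr
  linarith

lemma klInf_ne_top (hm0 : 0 < m) (hm1 : m < 1) {Q : Law} (hQ : Q ∈ postClass m) :
    klInf Q m ≠ ⊤ := by
  obtain ⟨l, -, hl⟩ := exists_klInf_le_growth hm0 hm1 hQ one_pos
  exact ne_top_of_le_ne_top ENNReal.ofReal_ne_top hl

/-- A vanishing `KL_inf` would force delays of larger order than `log γ`, but every betting fraction
with positive growth rate yields a delay of order `log γ`. -/
lemma klInf_ne_zero (hm0 : 0 < m) (hm1 : m < 1) (hΛc : Λ.Countable)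
    (hΛs : Λ ⊆ Set.Ioo 0 1) (hΛd : Set.Ioo 0 1 ⊆ closure Λ) (hw0 : ∀ l, 0 < w l)
    (hw1 : HasSum w 1) {Q : Law} (hQ : Q ∈ postClass m) : klInf Q m ≠ 0 := by
  intro h0
  have hQ' : m < mean Q := hQ
  obtain ⟨F, hF⟩ := exists_finset_klInf_le hm0 hm1 hΛs hΛd
    (show 0 < (mean Q - m) / 2 by linarith) one_pos
  obtain ⟨l, -, hg, -⟩ := hF Q (show m + (mean Q - m) / 2 < mean Q by linarith)
  have h1 := eventually_lt_cadd_div_log hm0 hm1 hΛc hΛs hw0 hw1 (Set.singleton_nonempty Q)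
    (Q := Q) (a := ENNReal.ofReal (2 / growth m Q l)) (by simp [h0])
  obtain ⟨γ, h2, h3, h4⟩ := (h1.and ((eventually_gt_atTop 1).and
    (Real.tendsto_log_atTop.eventually_ge_atTop (-Real.log (w l) - Real.log m)))).exists
  have hl0 : 0 < Real.log γ := Real.log_pos h3
  refine absurd h2 (not_lt.2 ?_)
  rw [ENNReal.div_le_iff (ENNReal.ofReal_pos.2 hl0).ne' ENNReal.ofReal_ne_top,
    ← ENNReal.ofReal_mul (by positivity)]
  refine (cadd_detector_le hm0 hm1 hΛc hΛs hw0 hw1 h3.le l hg _).trans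
    (ENNReal.ofReal_le_ofReal ?_)
  rw [div_mul_eq_mul_div]
  gcongr
  linarith

theorem tendsto_cadd_div_log (hm0 : 0 < m) (hm1 : m < 1) (hΛc : Λ.Countable)
    (hΛs : Λ ⊆ Set.Ioo 0 1) (hΛd : Set.Ioo 0 1 ⊆ closure Λ) (hw0 : ∀ l, 0 < w l)
    (hw1 : HasSum w 1) {Q : Law} (hQ : Q ∈ postClass m) {S : Set Law} (hS : S.Nonempty) :
    Tendsto (fun γ : ℝ => cadd S Q (detector m Λ w γ) / ENNReal.ofReal (Real.log γ))
      atTop (𝓝 (1 / klInf Q m)) := by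
  have hk0 := klInf_ne_zero hm0 hm1 hΛc hΛs hΛd hw0 hw1 hQ
  have hkt := klInf_ne_top hm0 hm1 hQ
  have hQ' : m < mean Q := hQ
  refine tendsto_order.2 ⟨fun a ha => eventually_lt_cadd_div_log hm0 hm1 hΛc hΛs hw0 hw1 hS ha,
    fun a ha => ?_⟩
  have ha' : 1 < klInf Q m * a := by
    rw [mul_comm]
    exact (ENNReal.div_lt_iff (Or.inl hk0) (Or.inl hkt)).1 ha
  obtain ⟨c, hc1, hc2⟩ := exists_between ha'
  filter_upwards [eventually_klInf_mul_cadd_le hm0 hm1 hΛc hΛs hΛd hw0 hw1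
    (show 0 < (mean Q - m) / 2 by linarith) hc1] with γ hγ
  have h1 := hγ Q (show m + (mean Q - m) / 2 < mean Q by linarith) S
  rw [mul_div_assoc] at h1
  exact lt_of_mul_lt_mul_left' (h1.trans_lt hc2)

theorem tendsto_iSup_klInf_mul_cadd (hm0 : 0 < m) (hm1 : m < 1) (hΛc : Λ.Countable)
    (hΛs : Λ ⊆ Set.Ioo 0 1) (hΛd : Set.Ioo 0 1 ⊆ closure Λ) (hw0 : ∀ l, 0 < w l)
    (hw1 : HasSum w 1) {Δ : ℝ} (hΔ : 0 < Δ) (hΔm : Δ < 1 - m) {S : Law → Set Law}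
    (hS : ∀ Q, (S Q).Nonempty) :
    Tendsto (fun γ : ℝ => ⨆ Q ∈ postClass (m + Δ),
        klInf Q m * cadd (S Q) Q (detector m Λ w γ) / ENNReal.ofReal (Real.log γ))
      atTop (𝓝 1) := by
  refine tendsto_order.2 ⟨fun a ha => ?_, fun a ha => ?_⟩
  · -- one law of the class, the point mass at `1`, already attains the limit
    let Q : Law := ⟨Measure.dirac 1, inferInstance⟩
    have hmean : mean Q = 1 := by simp [mean, Q]
    have hQ : Q ∈ postClass (m + Δ) := show m + Δ < mean Q by linarith
    have hQm : Q ∈ postClass m := show m < mean Q by linarith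
    have hk0 := klInf_ne_zero hm0 hm1 hΛc hΛs hΛd hw0 hw1 hQm
    have hkt := klInf_ne_top hm0 hm1 hQm
    have h1 := ENNReal.Tendsto.const_mul (a := klInf Q m)
      (tendsto_cadd_div_log hm0 hm1 hΛc hΛs hΛd hw0 hw1 hQm (hS Q)) (Or.inr hkt)
    rw [ENNReal.mul_div_cancel hk0 hkt] at h1
    filter_upwards [h1.eventually_const_lt ha] with γ hγ
    rw [← mul_div_assoc] at hγ
    exact hγ.trans_le (le_iSup₂ (f := fun Q (_ : Q ∈ postClass (m + Δ)) =>
      klInf Q m * cadd (S Q) Q (detector m Λ w γ) / ENNReal.ofReal (Real.log γ)) Q hQ)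
  · obtain ⟨c, hc1, hc2⟩ := exists_between ha
    filter_upwards [eventually_klInf_mul_cadd_le hm0 hm1 hΛc hΛs hΛd hw0 hw1 hΔ hc1] with γ hγ
    exact (iSup₂_le fun Q hQ => hγ Q hQ (S Q)).trans_lt hc2

end Optimality

end BoundedMean

theorem theorem3 (m : ℝ) (hm0 : 0 < m) (hm1 : m < 1)
    (Λ : Set ℝ) (hΛc : Λ.Countable) (hΛs : Λ ⊆ Set.Ioo 0 1) (hΛd : Set.Ioo 0 1 ⊆ closure Λ)
    (w : Λ → ℝ) (hw0 : ∀ l, 0 < w l) (hw1 : HasSum w 1) :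
    -- (i) ARL calibration
    (∀ γ : ℝ, 0 < γ →
      ENNReal.ofReal γ ≤ ⨅ P ∈ preClass m, arl P (detector m Λ w γ)) ∧
    -- (ii) pointwise asymptotic optimality, for any nonempty set `S` of pre-change laws
    (∀ Q ∈ postClass m, ∀ S : Set Law, S ⊆ preClass m → S.Nonempty →
      Tendsto (fun γ : ℝ => cadd S Q (detector m Λ w γ) / ENNReal.ofReal (Real.log γ))
        atTop (𝓝 (1 / klInf Q m))) ∧
    -- (iii) uniform optimality on separated classes; the set of pre-change laws may vary with `Q`
    (∀ Δ : ℝ, 0 < Δ → Δ < 1 - m →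
      ∀ S : Law → Set Law, (∀ Q, S Q ⊆ preClass m ∧ (S Q).Nonempty) →
        Tendsto (fun γ : ℝ => ⨆ Q ∈ postClass (m + Δ),
            klInf Q m * cadd (S Q) Q (detector m Λ w γ) / ENNReal.ofReal (Real.log γ))
          atTop (𝓝 1)) := by
  refine ⟨fun γ _ => le_iInf₂ fun P hP => le_arl_detector hm0 hm1 hΛc hΛs hw0 hw1 hP,
    fun Q hQ S _ hS => tendsto_cadd_div_log hm0 hm1 hΛc hΛs hΛd hw0 hw1 hQ hS,
    fun Δ hΔ hΔm S hS => tendsto_iSup_klInf_mul_cadd hm0 hm1 hΛc hΛs hΛd hw0 hw1 hΔ hΔm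
      fun Q => (hS Q).2⟩
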